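/- Let $A=-\frac{d^2}{dx^2}$ in $L^2(\mathbb R)$ (complex-valued functions) with domain $D(A)=H^2(\mathbb R)$, and let $A^0$ be the restriction of $A$ to $D(A^0)=\{\psi\in H^2(\mathbb R):\psi(0)=0\}$. For $-\infty<\sigma\le+\infty$ let $-\Delta_\sigma$ be the operator in $L^2(\mathbb R)$ with $$D(-\Delta_\sigma)=\{\zeta\in H^1(\mathbb R)\cap H^2(\mathbb R\setminus\{0\}) : \zeta'(0+)-\zeta'(0-)=\sigma\,\zeta(0)\},\qquad -\Delta_\sigma\zeta=-\zeta'',$$ where $\zeta''$ is the second weak derivative of $\zeta$ on $\mathbb R\setminus\{0\}$, values and one-sided limits are those of the continuous representatives, and for $\sigma=+\infty$ the boundary condition is read as $\zeta(0)=0$. Then the self-adjoint extensions of $A^0$ are exactly the operators $-\Delta_\sigma$, $-\infty<\sigma\le+\infty$: every $-\Delta_\sigma$ is a self-adjoint extension of $A^0$, and every self-adjoint extension of $A^0$ in $L^2(\mathbb R)$ equals $-\Delta_\sigma$ for some $\sigma\in(-\infty,+\infty]$. For $\sigma=0$ one has $-\Delta_0=-\Delta$, the operator $-\frac{d^2}{dx^2}$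 with domain $H^2(\mathbb R)$. For $\sigma=+\infty$, $$D(-\Delta_{+\infty})=\{\zeta\in H^1(\mathbb R)\cap H^2(\mathbb R\setminus\{0\}):\zeta(0)=0\}.$$ -/

import Mathlib

open MeasureTheory Set Filter Topology
open scoped ContDiff

noncomputable section

namespace PointInteraction

/-- The complex Hilbert space `L²(ℝ)`. Subsets of `ℝ` with null complement, such as `ℝ ∖ {0}`,
have the same `L²` space. -/
abbrev L2 : Type := Lp ℂ 2 (volume : Measure ℝ)

/-- `g` is the weak (distributional) derivative of `f` in the open set `Ω`:
`∫ φ' f = - ∫ φ g` for all test functions `φ ∈ C_c^∞(Ω)`. It suffices to use real test functions,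
as complex ones are complex combinations of them. -/
def IsWeakDeriv (Ω : Set ℝ) (f g : L2) : Prop :=
  ∀ φ : ℝ → ℝ, ContDiff ℝ ∞ φ → HasCompactSupport φ → tsupport φ ⊆ Ω →
    ∫ x, deriv φ x • f x = -∫ x, φ x • g x

theorem integrable_test_smul (f : L2) {φ : ℝ → ℝ} (hφ : Continuous φ) (hc : HasCompactSupport φ) :
    Integrable (fun x => φ x • f x) := by
  have h1 : LocallyIntegrable (f : ℝ → ℂ) volume :=
    (Lp.memLp f).locallyIntegrable (by norm_num)
  exact h1.integrable_smul_left_of_hasCompactSupport hφ hc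

theorem integral_test_add (f f' : L2) {φ : ℝ → ℝ} (hφ : Continuous φ)
    (hc : HasCompactSupport φ) :
    ∫ x, φ x • (f + f' : L2) x = (∫ x, φ x • f x) + ∫ x, φ x • f' x := by
  rw [← integral_add (integrable_test_smul f hφ hc) (integrable_test_smul f' hφ hc)]
  refine integral_congr_ae ?_
  filter_upwards [Lp.coeFn_add f f'] with x hx
  rw [hx, Pi.add_apply, smul_add]

theorem integral_test_smul (c : ℂ) (f : L2) (φ : ℝ → ℝ) :
    ∫ x, φ x • (c • f : L2) x = c * ∫ x, φ x • f x := by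
  rw [← integral_const_mul]
  refine integral_congr_ae ?_
  filter_upwards [Lp.coeFn_smul c f] with x hx
  simp only [hx, Pi.smul_apply, smul_eq_mul, Complex.real_smul]
  ring

theorem IsWeakDeriv.zero (Ω : Set ℝ) : IsWeakDeriv Ω 0 0 := by
  intro φ _ _ _
  have h := integral_test_smul 0 0
  simp only [zero_smul, zero_mul] at h
  rw [h, h, neg_zero]

theorem IsWeakDeriv.add {Ω : Set ℝ} {f g f' g' : L2} (h : IsWeakDeriv Ω f g)
    (h' : IsWeakDeriv Ω f' g') : IsWeakDeriv Ω (f + f') (g + g') := by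
  intro φ hφ hc hs
  rw [integral_test_add f f' (hφ.continuous_deriv (by simp)) hc.deriv,
    integral_test_add g g' hφ.continuous hc, h φ hφ hc hs, h' φ hφ hc hs]
  ring

theorem IsWeakDeriv.smul {Ω : Set ℝ} {f g : L2} (c : ℂ) (h : IsWeakDeriv Ω f g) :
    IsWeakDeriv Ω (c • f) (c • g) := by
  intro φ hφ hc hs
  rw [integral_test_smul c f (deriv φ), integral_test_smul, h φ hφ hc hs]
  ring

/-- Weak derivatives in open sets of full measure are unique. -/
theorem IsWeakDeriv.unique {Ω : Set ℝ} (hΩ : IsOpen Ω) (h0 : volume Ωᶜ = 0) {f g g' : L2}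
    (h : IsWeakDeriv Ω f g) (h' : IsWeakDeriv Ω f g') : g = g' := by
  have hz := h.add (h'.smul (-1))
  have hf : f + (-1 : ℂ) • f = 0 := by simp
  rw [hf] at hz
  have key : ∀ᵐ x ∂(volume : Measure ℝ), x ∈ Ω → (g + (-1 : ℂ) • g' : L2) x = 0 := by
    refine hΩ.ae_eq_zero_of_integral_contDiff_smul_eq_zero ?_ ?_
    · exact ((Lp.memLp _).locallyIntegrable (by norm_num)).locallyIntegrableOn _
    · intro φ hφ hc hs
      have h1 := hz φ hφ hc hs
      have h2 := integral_test_smul 0 0 (deriv φ)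
      simp only [zero_smul, zero_mul] at h2
      rw [h2] at h1
      exact neg_eq_zero.mp h1.symm
  have hmem : ∀ᵐ x ∂(volume : Measure ℝ), x ∈ Ω := h0
  have : (g + (-1 : ℂ) • g' : L2) = 0 := by
    rw [Lp.eq_zero_iff_ae_eq_zero]
    filter_upwards [key, hmem] with x hx hx'
    exact hx hx'
  have h3 : g - g' = 0 := by rw [← this]; simp [sub_eq_add_neg]
  exact sub_eq_zero.mp h3

/-- The Sobolev space `H^k(Ω) = W^{k,2}(Ω)` for an open set `Ω ⊆ ℝ` of full measure, as a subspace
of `L²(Ω) = L²(ℝ)`: the functions with weak derivatives in `Ω` up to order `k` that lie in `L²`. -/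
def sobolev (Ω : Set ℝ) : ℕ → Submodule ℂ L2
  | 0 => ⊤
  | k + 1 =>
    { carrier := {f | ∃ g ∈ sobolev Ω k, IsWeakDeriv Ω f g}
      zero_mem' := ⟨0, zero_mem _, IsWeakDeriv.zero Ω⟩
      add_mem' := by
        rintro f f' ⟨g, hg, h⟩ ⟨g', hg', h'⟩
        exact ⟨g + g', add_mem hg hg', h.add h'⟩
      smul_mem' := by
        rintro c f ⟨g, hg, h⟩
        exact ⟨c • g, Submodule.smul_mem _ c hg, h.smul c⟩ }

theorem exists_second_weakDeriv {Ω : Set ℝ} (f : sobolev Ω 2) :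
    ∃ h : L2, ∃ g : L2, IsWeakDeriv Ω f g ∧ IsWeakDeriv Ω g h := by
  obtain ⟨f, g, ⟨h, -, hh⟩, hg⟩ := f
  exact ⟨h, g, hg, hh⟩

/-- The second weak derivative in `Ω` of an element of `H²(Ω)`. -/
def secondWeakDeriv {Ω : Set ℝ} (f : sobolev Ω 2) : L2 := (exists_second_weakDeriv f).choose

theorem secondWeakDeriv_eq {Ω : Set ℝ} (hΩ : IsOpen Ω) (h0 : volume Ωᶜ = 0) (f : sobolev Ω 2)
    {g h : L2} (hg : IsWeakDeriv Ω f g) (hh : IsWeakDeriv Ω g h) : secondWeakDeriv f = h := by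
  obtain ⟨g', hg', hh'⟩ := (exists_second_weakDeriv f).choose_spec
  obtain rfl := hg.unique hΩ h0 hg'
  exact IsWeakDeriv.unique hΩ h0 hh' hh

/-- The operator `-d²/dx²` in `L²(ℝ)` with domain `H²(Ω)`, where `d/dx` is the weak derivative in
the open set `Ω` of full measure. -/
def negSecondDeriv (Ω : Set ℝ) (hΩ : IsOpen Ω) (h0 : volume Ωᶜ = 0) : L2 →ₗ.[ℂ] L2 where
  domain := sobolev Ω 2
  toFun :=
    { toFun := fun f => -secondWeakDeriv f
      map_add' := by
        intro f f'
        obtain ⟨g, hg, hh⟩ := (exists_second_weakDeriv f).choose_spec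
        obtain ⟨g', hg', hh'⟩ := (exists_second_weakDeriv f').choose_spec
        rw [secondWeakDeriv_eq hΩ h0 (f + f') (hg.add hg') (hh.add hh'), neg_add]
        rfl
      map_smul' := by
        intro c f
        obtain ⟨g, hg, hh⟩ := (exists_second_weakDeriv f).choose_spec
        rw [secondWeakDeriv_eq hΩ h0 (c • f) (hg.smul c) (hh.smul c), RingHom.id_apply, smul_neg]
        rfl }

/-- The free operator `-Δ = -d²/dx²` with domain `H²(ℝ)`. -/
def freeLaplacian : L2 →ₗ.[ℂ] L2 := negSecondDeriv univ isOpen_univ (by simp)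

/-- `f` has a continuous representative, and its value at `x` is `a`. -/
def HasValueAt (f : L2) (x : ℝ) (a : ℂ) : Prop :=
  ∃ u : ℝ → ℂ, Continuous u ∧ f =ᵐ[volume] u ∧ u x = a

/-- `f(x+) = a`: on the right of `x`, `f` has a continuous representative with limit `a` at `x`. -/
def HasRightLimit (f : L2) (x : ℝ) (a : ℂ) : Prop :=
  ∃ u : ℝ → ℂ, ContinuousOn u (Ioi x) ∧ f =ᵐ[volume.restrict (Ioi x)] u ∧
    Tendsto u (𝓝[>] x) (𝓝 a)

/-- `f(x-) = a`: on the left of `x`, `f` has a continuous representative with limit `a` at `x`. -/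
def HasLeftLimit (f : L2) (x : ℝ) (a : ℂ) : Prop :=
  ∃ u : ℝ → ℂ, ContinuousOn u (Iio x) ∧ f =ᵐ[volume.restrict (Iio x)] u ∧
    Tendsto u (𝓝[<] x) (𝓝 a)

theorem HasValueAt.zero (x : ℝ) : HasValueAt 0 x 0 :=
  ⟨fun _ => 0, continuous_const, Lp.coeFn_zero ℂ 2 volume, rfl⟩

theorem HasValueAt.add {f f' : L2} {x : ℝ} {a a' : ℂ} (h : HasValueAt f x a)
    (h' : HasValueAt f' x a') : HasValueAt (f + f') x (a + a') := by
  obtain ⟨u, hu, hf, rfl⟩ := h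
  obtain ⟨u', hu', hf', rfl⟩ := h'
  exact ⟨u + u', hu.add hu', (Lp.coeFn_add f f').trans (hf.add hf'), rfl⟩

theorem HasValueAt.smul {f : L2} {x : ℝ} {a : ℂ} (c : ℂ) (h : HasValueAt f x a) :
    HasValueAt (c • f) x (c * a) := by
  obtain ⟨u, hu, hf, rfl⟩ := h
  exact ⟨c • u, hu.const_smul c, (Lp.coeFn_smul c f).trans (hf.const_smul c), rfl⟩

theorem HasRightLimit.zero (x : ℝ) : HasRightLimit 0 x 0 :=
  ⟨fun _ => 0, continuousOn_const, ae_restrict_of_ae (Lp.coeFn_zero ℂ 2 volume),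
    tendsto_const_nhds⟩

theorem HasRightLimit.add {f f' : L2} {x : ℝ} {a a' : ℂ} (h : HasRightLimit f x a)
    (h' : HasRightLimit f' x a') : HasRightLimit (f + f') x (a + a') := by
  obtain ⟨u, hu, hf, ht⟩ := h
  obtain ⟨u', hu', hf', ht'⟩ := h'
  exact ⟨u + u', hu.add hu',
    (EventuallyEq.trans (ae_restrict_of_ae (Lp.coeFn_add f f')) (hf.add hf')), ht.add ht'⟩

theorem HasRightLimit.smul {f : L2} {x : ℝ} {a : ℂ} (c : ℂ) (h : HasRightLimit f x a) :
    HasRightLimit (c • f) x (c * a) := by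
  obtain ⟨u, hu, hf, ht⟩ := h
  exact ⟨c • u, hu.const_smul c,
    (EventuallyEq.trans (ae_restrict_of_ae (Lp.coeFn_smul c f)) (hf.const_smul c)),
    ht.const_smul c⟩

theorem HasLeftLimit.zero (x : ℝ) : HasLeftLimit 0 x 0 :=
  ⟨fun _ => 0, continuousOn_const, ae_restrict_of_ae (Lp.coeFn_zero ℂ 2 volume),
    tendsto_const_nhds⟩

theorem HasLeftLimit.add {f f' : L2} {x : ℝ} {a a' : ℂ} (h : HasLeftLimit f x a)
    (h' : HasLeftLimit f' x a') : HasLeftLimit (f + f') x (a + a') := by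
  obtain ⟨u, hu, hf, ht⟩ := h
  obtain ⟨u', hu', hf', ht'⟩ := h'
  exact ⟨u + u', hu.add hu',
    (EventuallyEq.trans (ae_restrict_of_ae (Lp.coeFn_add f f')) (hf.add hf')), ht.add ht'⟩

theorem HasLeftLimit.smul {f : L2} {x : ℝ} {a : ℂ} (c : ℂ) (h : HasLeftLimit f x a) :
    HasLeftLimit (c • f) x (c * a) := by
  obtain ⟨u, hu, hf, ht⟩ := h
  exact ⟨c • u, hu.const_smul c,
    (EventuallyEq.trans (ae_restrict_of_ae (Lp.coeFn_smul c f)) (hf.const_smul c)),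
    ht.const_smul c⟩

/-- The functions with a continuous representative that vanishes at `0`. -/
def vanishingAtZero : Submodule ℂ L2 where
  carrier := {f | HasValueAt f 0 0}
  zero_mem' := HasValueAt.zero 0
  add_mem' := fun h h' => by simpa using HasValueAt.add h h'
  smul_mem' := fun c _ h => by simpa using HasValueAt.smul c h

/-- The symmetric operator `A⁰`: the restriction of `-d²/dx²` on `H²(ℝ)` to
`{ψ ∈ H²(ℝ) : ψ(0) = 0}`. -/
def minimalOp : L2 →ₗ.[ℂ] L2 := freeLaplacian.domRestrict vanishingAtZero

/-- The boundary condition `ζ'(0+) - ζ'(0-) = σ ζ(0)` for real `σ`, and `ζ(0) = 0` for `σ = +∞`.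
For `ζ ∈ H¹(ℝ) ∩ H²(ℝ ∖ {0})` the value and the one-sided limits always exist, and they are
unique. -/
def BoundaryCondition (σ : WithTop ℝ) (ζ : L2) : Prop :=
  ∃ (ζ' : L2) (z p m : ℂ), IsWeakDeriv {0}ᶜ ζ ζ' ∧
    HasValueAt ζ 0 z ∧ HasRightLimit ζ' 0 p ∧ HasLeftLimit ζ' 0 m ∧
    (∀ s : ℝ, σ = s → p - m = s * z) ∧ (σ = ⊤ → z = 0)

/-- The functions in `L²(ℝ)` that satisfy the boundary condition at `0` with parameter `σ`. -/
def boundarySubmodule (σ : WithTop ℝ) : Submodule ℂ L2 where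
  carrier := {ζ | BoundaryCondition σ ζ}
  zero_mem' := ⟨0, 0, 0, 0, IsWeakDeriv.zero _, HasValueAt.zero 0, HasRightLimit.zero 0,
    HasLeftLimit.zero 0, by simp, by simp⟩
  add_mem' := by
    rintro f f' ⟨g, z, p, m, hg, hz, hp, hm, hs, ht⟩ ⟨g', z', p', m', hg', hz', hp', hm', hs', ht'⟩
    refine ⟨g + g', z + z', p + p', m + m', hg.add hg', hz.add hz', hp.add hp', hm.add hm', ?_, ?_⟩
    · intro s h
      linear_combination hs s h + hs' s h
    · intro h
      rw [ht h, ht' h, add_zero]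
  smul_mem' := by
    rintro c f ⟨g, z, p, m, hg, hz, hp, hm, hs, ht⟩
    refine ⟨c • g, c * z, c * p, c * m, hg.smul c, hz.smul c, hp.smul c, hm.smul c, ?_, ?_⟩
    · intro s h
      linear_combination c * hs s h
    · intro h
      rw [ht h, mul_zero]

/-- The operator `-Δ_σ`, `-∞ < σ ≤ +∞`: it acts as `-d²/dx²` in `ℝ ∖ {0}`, with domain
`{ζ ∈ H¹(ℝ) ∩ H²(ℝ ∖ {0}) : ζ'(0+) - ζ'(0-) = σ ζ(0)}`. -/
def deltaOp (σ : WithTop ℝ) : L2 →ₗ.[ℂ] L2 :=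
  (negSecondDeriv {0}ᶜ isOpen_compl_singleton (by simp)).domRestrict
    (sobolev univ 1 ⊓ boundarySubmodule σ)

end PointInteraction

end

open PointInteraction

/-! Write `A` for `-d²/dx²` on `H²(ℝ)` and `G(x) = exp (-|x|)`. Since `-G'' + G = 2δ₀`, evaluation
at `0` is `u(0) = ⟨G, (A + 1) u⟩ / 2` (`inner_green`, `traceAt_green`). Hence `A⁰` is the
restriction of `A` to the kernel of a functional represented by a vector `G` outside `D(A)`, and the
extension problem becomes Hilbert space algebra (`SingularPair`).

As `A` is symmetric and `A + 1` is onto, the adjoint of `A⁰` acts by `u + c G ↦ A u - c G` on `D(A)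
⊕ ℂ G` (`exists_decomposition`). Its boundary form depends only on the pairs `(u(0), c)` and is
symplectic (`boundary_form`). Self-adjoint extensions therefore correspond to Lagrangian lines in
`ℂ²`, which are the lines `γ u(0) = α c` with real `(α, γ) ≠ 0` (`IsPointExtension.isSelfAdjoint`,
`exists_isPointExtension`).

The function `ζ = u + c G` has `ζ(0) = u(0) + c`, and its derivative jumps by `-2c`. So the
condition with parameter `σ` reads `-σ u(0) = (2 + σ) c`, and `u(0) = -c` for `σ = +∞`; these are
all the real lines (`isPointExtension_deltaOp_of_iff`, `exists_eq_deltaOp`).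

The analysis rests on `HasTraces`: weak derivatives off `0` are described by primitives on the two
half-lines, with explicit one-sided limits. -/

noncomputable section

namespace PointInteraction

/-! ### Self-adjoint extensions in an abstract Hilbert space. -/

section Abstract

variable {H : Type*} [NormedAddCommGroup H] [InnerProductSpace ℂ H]

/-- Half the pairing of `G` with `(A + 1) u`. For `A = -d²/dx²` and `G(x) = exp (-|x|)`
this is `u(0)`. -/
def traceAt (A : H →ₗ.[ℂ] H) (G : H) (u : A.domain) : ℂ := inner ℂ G (A u + (u : H)) / 2

theorem inner_eq_traceAt (A : H →ₗ.[ℂ] H) (G : H) (u : A.domain) :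
    inner ℂ G (A u + (u : H)) = 2 * traceAt A G u := by
  simp [traceAt]; ring

theorem traceAt_add (A : H →ₗ.[ℂ] H) (G : H) (u v : A.domain) :
    traceAt A G (u + v) = traceAt A G u + traceAt A G v := by
  simp only [traceAt, LinearPMap.map_add, Submodule.coe_add, inner_add_right]; ring

theorem traceAt_smul (A : H →ₗ.[ℂ] H) (G : H) (c : ℂ) (u : A.domain) :
    traceAt A G (c • u) = c * traceAt A G u := by
  simp only [traceAt, LinearPMap.map_smul, Submodule.coe_smul, ← smul_add, inner_smul_right]; ring

/-- The data of a rank one singular perturbation: a symmetric operator `A` with `A + 1` onto, and a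
vector `G` outside of the domain of `A`. -/
structure SingularPair (A : H →ₗ.[ℂ] H) (G : H) : Prop where
  symm : ∀ u v : A.domain, inner ℂ (A u) (v : H) = inner ℂ (u : H) (A v)
  surj : ∀ v : H, ∃ u : A.domain, A u + (u : H) = v
  notMem : G ∉ A.domain

/-- `T` acts by `u + c G ↦ A u - c G` on the vectors `u + c G` with `γ u(0) = α c`. -/
structure IsPointExtension (A : H →ₗ.[ℂ] H) (G : H) (α γ : ℝ) (T : H →ₗ.[ℂ] H) : Prop where
  mem_iff : ∀ f : H, f ∈ T.domain ↔
    ∃ (u : A.domain) (c : ℂ), f = u + c • G ∧ γ * traceAt A G u = α * c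
  apply_eq : ∀ (f : T.domain) (u : A.domain) (c : ℂ), (f : H) = u + c • G → T f = A u - c • G

variable {A T T' : H →ₗ.[ℂ] H} {G : H} {α γ : ℝ}

theorem IsPointExtension.eq (h : IsPointExtension A G α γ T) (h' : IsPointExtension A G α γ T') :
    T = T' := by
  apply LinearPMap.eq_of_le_of_domain_eq
  · refine ⟨fun f hf => (h'.mem_iff f).2 ((h.mem_iff f).1 hf), ?_⟩
    intro x y hxy
    obtain ⟨u, c, hf, -⟩ := (h.mem_iff x).1 x.2
    rw [h.apply_eq x u c hf, h'.apply_eq y u c (hxy ▸ hf)]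
  · ext f
    rw [h.mem_iff, h'.mem_iff]

theorem IsPointExtension.of_scale (h : IsPointExtension A G α γ T) {α' γ' r : ℝ} (hr : r ≠ 0)
    (hα : α' = r * α) (hγ : γ' = r * γ) : IsPointExtension A G α' γ' T := by
  refine ⟨fun f => (h.mem_iff f).trans ?_, h.apply_eq⟩
  have hr' : (r : ℂ) ≠ 0 := by exact_mod_cast hr
  subst hα hγ
  push_cast
  simp only [mul_assoc, mul_right_inj' hr']

/-- The boundary form of the maximal operator `u + c G ↦ A u - c G`. -/
theorem SingularPair.boundary_form (h : SingularPair A G) (u v : A.domain) (c d : ℂ) :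
    inner ℂ (A u - c • G) ((v : H) + d • G) - inner ℂ ((u : H) + c • G) (A v - d • G) =
      2 * (d * (starRingEnd ℂ) (traceAt A G u) - (starRingEnd ℂ) c * traceAt A G v) := by
  have h1 := inner_eq_traceAt A G v
  have h2 := congrArg (starRingEnd ℂ) (inner_eq_traceAt A G u)
  rw [inner_conj_symm] at h2
  simp only [inner_add_right, inner_add_left, inner_sub_left, inner_sub_right, inner_smul_left,
    inner_smul_right, map_mul, Complex.conj_ofNat, h.symm u v] at h1 h2 ⊢
  -- The `⟨G, G⟩` terms cancel and symmetry removes `⟨A u, v⟩`; what remains is `d ⟨(A + 1) u, G⟩ -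
  -- c̄ ⟨G, (A + 1) v⟩`.
  linear_combination d * h2 - (starRingEnd ℂ) c * h1

theorem SingularPair.traceAt_surjective (h : SingularPair A G) (a : ℂ) :
    ∃ u : A.domain, traceAt A G u = a := by
  have hG : G ≠ 0 := fun h0 => h.notMem (h0 ▸ zero_mem _)
  have hG' : inner ℂ G G ≠ (0 : ℂ) := inner_self_ne_zero.2 hG
  obtain ⟨u, hu⟩ := h.surj ((2 * a / inner ℂ G G) • G)
  refine ⟨u, ?_⟩
  rw [traceAt, hu, inner_smul_right]
  field_simp

theorem SingularPair.decomposition_unique (h : SingularPair A G) {u v : A.domain} {c d : ℂ}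
    (he : (u : H) + c • G = v + d • G) : u = v ∧ c = d := by
  have h1 : (c - d) • G = ((v - u : A.domain) : H) := by
    rw [sub_smul, Submodule.coe_sub, sub_eq_sub_iff_add_eq_add, add_comm, he, add_comm]
  have hcd : c = d := by
    by_contra hne
    apply h.notMem
    have h2 : G = (c - d)⁻¹ • ((v - u : A.domain) : H) := by
      rw [← h1, inv_smul_smul₀ (sub_ne_zero.2 hne)]
    rw [h2]
    exact Submodule.smul_mem _ _ (v - u).2
  subst hcd
  exact ⟨Subtype.ext (add_right_cancel he), rfl⟩

/-- The line `ℂ G` is finite dimensional, so it equals its double orthogonal complement even in an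
incomplete space. -/
theorem mem_span_of_inner_eq_zero {G z : H}
    (h : ∀ x : H, inner ℂ G x = (0 : ℂ) → inner ℂ z x = (0 : ℂ)) : ∃ c : ℂ, z = c • G := by
  have hz : z ∈ (ℂ ∙ G)ᗮᗮ := by
    rw [Submodule.mem_orthogonal']
    intro x hx
    exact h x ((Submodule.mem_orthogonal_singleton_iff_inner_right).1 hx)
  rw [Submodule.orthogonal_orthogonal, Submodule.mem_span_singleton] at hz
  obtain ⟨c, hc⟩ := hz
  exact ⟨c, hc.symm⟩

/-- The adjoint of the restriction of `A` to the kernel of the trace. -/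
theorem SingularPair.exists_decomposition (h : SingularPair A G) {v w : H}
    (hvw : ∀ u : A.domain, traceAt A G u = 0 → inner ℂ w (u : H) = inner ℂ v (A u)) :
    ∃ (y : A.domain) (c : ℂ), v = y + c • G ∧ w = A y - c • G := by
  -- With `(A + 1) y = w + v`, symmetry makes `v - y` orthogonal to `(A + 1) u` whenever `u` has
  -- zero trace. As `A + 1` is onto, these vectors fill the orthogonal complement of `G`.
  obtain ⟨y, hy⟩ := h.surj (w + v)
  obtain ⟨c, hc⟩ : ∃ c : ℂ, v - y = c • G := by
    apply mem_span_of_inner_eq_zero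
    intro x hx
    obtain ⟨u, rfl⟩ := h.surj x
    have hu : traceAt A G u = 0 := by rw [traceAt, hx, zero_div]
    have h1 := hvw u hu
    have h2 : inner ℂ (A y + (y : H)) (u : H) = inner ℂ (w + v) (u : H) := by rw [hy]
    have h3 := h.symm y u
    simp only [inner_add_left, inner_add_right, inner_sub_left] at h2 ⊢
    linear_combination h3 - h1 - h2
  refine ⟨y, c, ?_, ?_⟩
  · rw [← hc]; abel
  · rw [← hc, sub_sub_eq_add_sub, hy, add_sub_cancel_right]

/-- The pair `(0, v)` satisfies the adjoint relation, and `0` decomposes only trivially. This gives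
density of the kernel of the trace. -/
theorem SingularPair.eq_zero_of_orthogonal_ker (h : SingularPair A G) {v : H}
    (hv : ∀ u : A.domain, traceAt A G u = 0 → inner ℂ v (u : H) = (0 : ℂ)) : v = 0 := by
  obtain ⟨y, c, h0, h1⟩ := h.exists_decomposition (v := 0) (w := v)
    (fun u hu => by rw [hv u hu, inner_zero_left])
  obtain ⟨hy, hc⟩ := h.decomposition_unique (u := 0) (v := y) (c := 0) (d := c) (by simpa using h0)
  rw [h1, ← hy, ← hc]
  simp

theorem IsPointExtension.ker_le (hT : IsPointExtension A G α γ T) (u : A.domain)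
    (hu : traceAt A G u = 0) : (u : H) ∈ T.domain :=
  (hT.mem_iff u).2 ⟨u, 0, by simp, by simp [hu]⟩

variable [CompleteSpace H]

theorem SingularPair.dense_of_ker_le (h : SingularPair A G)
    (hT : ∀ u : A.domain, traceAt A G u = 0 → (u : H) ∈ T.domain) :
    Dense (T.domain : Set H) := by
  rw [Submodule.dense_iff_topologicalClosure_eq_top,
    Submodule.topologicalClosure_eq_top_iff, Submodule.eq_bot_iff]
  intro v hv
  exact h.eq_zero_of_orthogonal_ker
    fun u hu => (Submodule.mem_orthogonal' _ _).1 hv u (hT u hu)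

/-- Two pairs on the same real line annihilate the boundary form, so `T` is symmetric. Conversely, a
pair annihilated by the whole line lies on it, so the adjoint is no larger. -/
theorem IsPointExtension.isSelfAdjoint (h : SingularPair A G) (hT : IsPointExtension A G α γ T)
    (hαγ : α ≠ 0 ∨ γ ≠ 0) : IsSelfAdjoint T := by
  have hd : Dense (T.domain : Set H) := h.dense_of_ker_le hT.ker_le
  have hle : T ≤ T.adjoint := by
    refine LinearPMap.IsFormalAdjoint.le_adjoint hd fun f g => ?_
    obtain ⟨u, c, hf, hu⟩ := (hT.mem_iff f).1 f.2
    obtain ⟨v, d, hg, hv⟩ := (hT.mem_iff g).1 g.2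
    rw [hT.apply_eq f u c hf, hT.apply_eq g v d hg, hf, hg, ← sub_eq_zero, h.boundary_form]
    have hu' := congrArg (starRingEnd ℂ) hu
    simp only [map_mul, Complex.conj_ofReal] at hu'
    rcases hαγ with hα | hγ
    · have hα' : (α : ℂ) ≠ 0 := by exact_mod_cast hα
      apply mul_left_cancel₀ hα'
      linear_combination 2 * traceAt A G v * hu' - 2 * (starRingEnd ℂ) (traceAt A G u) * hv
    · have hγ' : (γ : ℂ) ≠ 0 := by exact_mod_cast hγ
      apply mul_left_cancel₀ hγ'
      linear_combination 2 * d * hu' - 2 * (starRingEnd ℂ) c * hv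
  rw [LinearPMap.isSelfAdjoint_def]
  refine (LinearPMap.eq_of_le_of_domain_eq hle (le_antisymm hle.1 fun v hv => ?_)).symm
  have hadj := LinearPMap.adjoint_isFormalAdjoint hd ⟨v, hv⟩
  set w := T.adjoint ⟨v, hv⟩ with hw
  obtain ⟨y, c, hvy, hwy⟩ := h.exists_decomposition (v := v) (w := w) (fun u hu => by
    have := hadj ⟨u, hT.ker_le u hu⟩
    rw [hT.apply_eq ⟨u, hT.ker_le u hu⟩ u 0 (by simp)] at this
    simpa using this)
  -- The vector `x + γ G` has boundary pair `(α, γ)`, which spans the line; pairing `v` with it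
  -- yields the missing relation for `v`.
  obtain ⟨x, hx⟩ := h.traceAt_surjective α
  have hxT : (x : H) + (γ : ℂ) • G ∈ T.domain := (hT.mem_iff _).2 ⟨x, γ, rfl, by rw [hx]; ring⟩
  have h1 := hadj ⟨_, hxT⟩
  rw [hT.apply_eq ⟨_, hxT⟩ x γ rfl, hwy] at h1
  change inner ℂ _ ((x : H) + (γ : ℂ) • G) = inner ℂ v _ at h1
  rw [hvy, ← sub_eq_zero, h.boundary_form, hx] at h1
  have h2 := congrArg (starRingEnd ℂ) h1
  simp only [map_mul, map_sub, Complex.conj_ofReal, Complex.conj_conj, map_zero,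
    Complex.conj_ofNat] at h2
  exact (hT.mem_iff v).2 ⟨y, c, hvy, by linear_combination h2 / 2⟩

/-- Symmetry of `T` makes its boundary pairs an isotropic subspace of `ℂ²`, and self-adjointness
makes it nonzero. Such a subspace is a line with a real direction. -/
theorem SingularPair.exists_isPointExtension (h : SingularPair A G) (hT : IsSelfAdjoint T)
    (hker : ∀ u : A.domain, traceAt A G u = 0 → ∃ hu : (u : H) ∈ T.domain, T ⟨u, hu⟩ = A u) :
    ∃ α γ : ℝ, (α ≠ 0 ∨ γ ≠ 0) ∧ IsPointExtension A G α γ T := by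
  have hd := hT.dense_domain
  have hsa : ∀ f g : T.domain, inner ℂ (T f) (g : H) = inner ℂ (f : H) (T g) := by
    have := LinearPMap.adjoint_isFormalAdjoint hd
    rw [LinearPMap.isSelfAdjoint_def.1 hT] at this
    exact this
  have hdec : ∀ f : T.domain, ∃ (y : A.domain) (c : ℂ), (f : H) = y + c • G ∧ T f = A y - c • G :=
    fun f => h.exists_decomposition fun u hu => by
      obtain ⟨hu', hTu⟩ := hker u hu
      rw [← hTu]
      exact hsa f ⟨u, hu'⟩
  have happ : ∀ (f : T.domain) (u : A.domain) (c : ℂ), (f : H) = u + c • G →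
      T f = A u - c • G := by
    intro f u c hf
    obtain ⟨y, d, hf', hTf⟩ := hdec f
    obtain ⟨rfl, rfl⟩ := h.decomposition_unique (hf.symm.trans hf')
    exact hTf
  have hform : ∀ (f g : T.domain) (u v : A.domain) (c d : ℂ), (f : H) = u + c • G →
      (g : H) = v + d • G →
      d * (starRingEnd ℂ) (traceAt A G u) = (starRingEnd ℂ) c * traceAt A G v := by
    intro f g u v c d hf hg
    have h1 := hsa f g
    rw [happ f u c hf, happ g v d hg, hf, hg, ← sub_eq_zero, h.boundary_form] at h1
    linear_combination h1 / 2
  obtain ⟨f₀, y₀, c₀, hf₀, hne⟩ : ∃ (f : T.domain) (y : A.domain) (c : ℂ),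
      (f : H) = y + c • G ∧ ¬(traceAt A G y = 0 ∧ c = 0) := by
    -- If all boundary pairs vanished, `G` would lie in the domain of the adjoint with image `-G`.
    -- Then `G` would lie in `D(T)` with pair zero, hence in `D(A)`.
    by_contra! hcon
    have hG : G ∈ T.adjoint.domain := by
      refine LinearPMap.mem_adjoint_domain_of_exists _ ⟨-G, fun f => ?_⟩
      obtain ⟨y, c, hf, hTf⟩ := hdec f
      obtain ⟨hy, rfl⟩ := hcon f y c hf
      have h1 := inner_eq_traceAt A G y
      rw [hy, mul_zero, inner_add_right] at h1
      rw [hTf, hf]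
      simp only [zero_smul, add_zero, sub_zero, inner_neg_left]
      linear_combination -h1
    rw [LinearPMap.isSelfAdjoint_def.1 hT] at hG
    obtain ⟨y, c, hf, -⟩ := hdec ⟨G, hG⟩
    obtain ⟨-, rfl⟩ := hcon ⟨G, hG⟩ y c hf
    apply h.notMem
    have : G = y := by simpa using hf
    rw [this]
    exact y.2
  have hself := hform f₀ f₀ y₀ y₀ c₀ c₀ hf₀ hf₀
  -- By `hself` the ratio of `c₀` to the trace of `y₀` is real, so the pair of `f₀` is a complex
  -- multiple `l` of a real one.
  obtain ⟨α, γ, l, hαγ, hl, hα, hγ⟩ : ∃ (α γ : ℝ) (l : ℂ), (α ≠ 0 ∨ γ ≠ 0) ∧ l ≠ 0 ∧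
      traceAt A G y₀ = l * α ∧ c₀ = l * γ := by
    by_cases ha : traceAt A G y₀ = 0
    · exact ⟨0, 1, c₀, by simp, fun hc => hne ⟨ha, hc⟩, by simp [ha], by simp⟩
    · have hreal : (starRingEnd ℂ) (c₀ / traceAt A G y₀) = c₀ / traceAt A G y₀ := by
        rw [map_div₀, div_eq_div_iff (by simpa using ha) ha, hself]
      obtain ⟨r, hr⟩ := Complex.conj_eq_iff_real.1 hreal
      refine ⟨1, r, _, by simp, ha, by simp, ?_⟩
      rw [← hr]
      field_simp
  refine ⟨α, γ, hαγ, fun f => ⟨fun hf => ?_, ?_⟩, happ⟩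
  · obtain ⟨y, c, hfy, -⟩ := hdec ⟨f, hf⟩
    refine ⟨y, c, hfy, ?_⟩
    have h1 := hform f₀ ⟨f, hf⟩ y₀ y c₀ c hf₀ hfy
    rw [hα, hγ, map_mul, map_mul, Complex.conj_ofReal, Complex.conj_ofReal] at h1
    apply mul_left_cancel₀ ((map_ne_zero (starRingEnd ℂ)).2 hl)
    linear_combination -h1
  · rintro ⟨u, c, rfl, huc⟩
    obtain ⟨r, hr, hr'⟩ : ∃ r : ℂ, traceAt A G u = r * traceAt A G y₀ ∧ c = r * c₀ := by
      rw [hα, hγ]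
      rcases hαγ with h0 | h0
      · have h0' : (α : ℂ) ≠ 0 := by exact_mod_cast h0
        refine ⟨traceAt A G u / (l * α), by field_simp, ?_⟩
        field_simp
        linear_combination -huc
      · have h0' : (γ : ℂ) ≠ 0 := by exact_mod_cast h0
        refine ⟨c / (l * γ), ?_, by field_simp⟩
        field_simp
        linear_combination huc
    -- `u + c G` is `r f₀` plus the vector `u - r y₀` of zero trace.
    obtain ⟨hk, -⟩ := hker (u + (-r) • y₀) (by rw [traceAt_add, traceAt_smul, hr]; ring)
    have h2 := add_mem hk (Submodule.smul_mem _ r f₀.2)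
    convert h2 using 1
    rw [hf₀, hr', Submodule.coe_add, Submodule.coe_smul]
    module

end Abstract

/-! ### Primitives of locally integrable functions. -/

section Primitive

variable {g : ℝ → ℂ} {a b : ℝ}

theorem intervalIntegrable_of_locallyIntegrable (hg : LocallyIntegrable g volume) (a b : ℝ) :
    IntervalIntegrable g volume a b :=
  intervalIntegrable_iff.mpr <|
    (hg.integrableOn_isCompact isCompact_uIcc).mono_set uIoc_subset_uIcc

theorem absolutelyContinuousOnInterval_const (z : ℂ) (a b : ℝ) :
    AbsolutelyContinuousOnInterval (fun _ : ℝ => z) a b :=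
  (contDiff_const (n := 1) (𝕜 := ℝ)).contDiffOn.absolutelyContinuousOnInterval

theorem absolutelyContinuousOnInterval_ofReal_integral {r : ℝ → ℝ}
    (hr : IntervalIntegrable r volume a b) (z : ℂ) :
    AbsolutelyContinuousOnInterval (fun x => (∫ t in a..x, r t) • z) a b :=
  (hr.absolutelyContinuousOnInterval_intervalIntegral left_mem_uIcc).smul
    (absolutelyContinuousOnInterval_const z a b)

theorem absolutelyContinuousOnInterval_integral (hg : IntervalIntegrable g volume a b) :
    AbsolutelyContinuousOnInterval (fun x => ∫ t in a..x, g t) a b := by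
  have hre : IntervalIntegrable (fun x => (g x).re) volume a b :=
    ⟨hg.1.re, hg.2.re⟩
  have him : IntervalIntegrable (fun x => (g x).im) volume a b :=
    ⟨hg.1.im, hg.2.im⟩
  have h := (absolutelyContinuousOnInterval_ofReal_integral hre 1).add
    (absolutelyContinuousOnInterval_ofReal_integral him Complex.I)
  have key : ∀ x ∈ uIcc a b, (∫ t in a..x, g t) =
      (∫ t in a..x, (g t).re) • (1 : ℂ) + (∫ t in a..x, (g t).im) • Complex.I := by
    intro x hx
    have hs : uIcc a x ⊆ uIcc a b := uIcc_subset_uIcc left_mem_uIcc hx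
    have h1 : ∫ t in a..x, g t = ∫ t in a..x, ((g t).re • (1 : ℂ) + (g t).im • Complex.I) := by
      congr 1; ext t
      simp [Complex.re_add_im]
    rw [h1, intervalIntegral.integral_add, intervalIntegral.integral_smul_const,
      intervalIntegral.integral_smul_const]
    · exact ⟨(hre.mono_set hs).1.smul_const _, (hre.mono_set hs).2.smul_const _⟩
    · exact ⟨(him.mono_set hs).1.smul_const _, (him.mono_set hs).2.smul_const _⟩
  -- `key` is available only on `uIcc a b`; the ε–δ form of absolute continuity sees no other
  -- points.
  rw [absolutelyContinuousOnInterval_iff] at h ⊢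
  intro ε hε
  obtain ⟨δ, hδ, H⟩ := h ε hε
  refine ⟨δ, hδ, fun E hE hlt => ?_⟩
  refine lt_of_eq_of_lt (Finset.sum_congr rfl fun i hi => ?_) (H E hE hlt)
  have h2 := hE.1 i hi
  simp only [key _ h2.1, key _ h2.2, Pi.add_apply]

/-- `F` minus the primitive of `k` is absolutely continuous with derivative zero almost everywhere,
hence constant. -/
theorem integral_eq_sub_of_absolutelyContinuous {F k : ℝ → ℂ}
    (hF : AbsolutelyContinuousOnInterval F a b) (hk : IntervalIntegrable k volume a b)
    (hd : ∀ᵐ x, x ∈ uIcc a b → HasDerivAt F (k x) x) :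
    ∫ x in a..b, k x = F b - F a := by
  have hac := hF.sub (absolutelyContinuousOnInterval_integral hk)
  have hz : ∀ᵐ x, x ∈ uIcc a b → HasDerivAt (F - fun x => ∫ t in a..x, k t) 0 x := by
    filter_upwards [hd, hk.ae_hasDerivAt_integral] with x h1 h2 hx
    simpa using (h1 hx).sub (h2 hx a left_mem_uIcc)
  obtain ⟨C, hC⟩ := hac.const_of_ae_hasDerivAt_zero hz
  have ha := hC a left_mem_uIcc
  have hb := hC b right_mem_uIcc
  simp only [Pi.sub_apply, intervalIntegral.integral_same, sub_zero] at ha hb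
  rw [ha, ← hb]
  ring

/-- Integration by parts for a smooth function and a primitive of a locally integrable one. -/
theorem integral_smul_primitive (hg : LocallyIntegrable g volume) {φ : ℝ → ℝ}
    (hφ : ContDiff ℝ 1 φ) (c : ℂ) (a b : ℝ) :
    ∫ x in a..b, (deriv φ x • (c + ∫ t in (0 : ℝ)..x, g t) + φ x • g x) =
      φ b • (c + ∫ t in (0 : ℝ)..b, g t) - φ a • (c + ∫ t in (0 : ℝ)..a, g t) := by
  have hi := intervalIntegrable_of_locallyIntegrable hg
  have hcont : Continuous fun x => ∫ t in (0 : ℝ)..x, g t := intervalIntegral.continuous_primitive hi 0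
  have hac : AbsolutelyContinuousOnInterval (fun x => c + ∫ t in (0 : ℝ)..x, g t) a b := by
    have h := (absolutelyContinuousOnInterval_const (c + ∫ t in (0 : ℝ)..a, g t) a b).add
      (absolutelyContinuousOnInterval_integral (hi a b))
    convert! h using 1
    ext x
    rw [Pi.add_apply, add_assoc, intervalIntegral.integral_add_adjacent_intervals (hi _ _) (hi _ _)]
  have hd := hφ.continuous_deriv le_rfl
  refine integral_eq_sub_of_absolutelyContinuous
    (F := fun x => φ x • (c + ∫ t in (0 : ℝ)..x, g t))
    (hφ.contDiffOn.absolutelyContinuousOnInterval.smul hac) ?_ ?_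
  · refine IntervalIntegrable.add ?_ ?_
    · exact (hd.smul (continuous_const.add hcont)).intervalIntegrable _ _
    · exact (hi a b).continuousOn_smul hφ.continuous.continuousOn
  · filter_upwards [_root_.LocallyIntegrable.ae_hasDerivAt_integral hg] with x hx _
    have h1 := ((hφ.differentiable (by simp)) x).hasDerivAt
    have h2 := h1.smul ((hx 0).const_add c)
    rwa [add_comm] at h2

end Primitive

/-! ### Weak derivatives and primitives on intervals. -/

/-- The weak derivative of a primitive. -/
theorem integral_deriv_smul_primitive {g : ℝ → ℂ} (hg : LocallyIntegrable g volume) (c : ℂ)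
    {φ : ℝ → ℝ} (hφ : ContDiff ℝ ∞ φ) (hc : HasCompactSupport φ) :
    ∫ x, deriv φ x • (c + ∫ t in (0 : ℝ)..x, g t) = -∫ x, φ x • g x := by
  have hi := intervalIntegrable_of_locallyIntegrable hg
  have hcont : Continuous fun x => c + ∫ t in (0 : ℝ)..x, g t :=
    continuous_const.add (intervalIntegral.continuous_primitive hi 0)
  have hd : Continuous (deriv φ) := hφ.continuous_deriv (by simp)
  have i1 : Integrable fun x => deriv φ x • (c + ∫ t in (0 : ℝ)..x, g t) :=
    (hd.smul hcont).integrable_of_hasCompactSupport hc.deriv.smul_right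
  have i2 : Integrable fun x => φ x • g x :=
    hg.integrable_smul_left_of_hasCompactSupport hφ.continuous hc
  rw [eq_neg_iff_add_eq_zero, ← integral_add i1 i2]
  obtain ⟨R, hR⟩ := hc.isCompact.isBounded.subset_closedBall 0
  have hz : ∀ x, R < |x| → φ x = 0 := by
    intro x hx
    by_contra h
    have := hR (subset_tsupport _ h)
    simp at this
    linarith
  -- The endpoints lie strictly outside the support, so the boundary terms vanish; `|R|` is used
  -- because the sign of `R` is unknown.
  have h := integral_smul_primitive hg (hφ.of_le (by simp)) c (-(|R| + 1)) (|R| + 1)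
  have hR1 : R < |R| + 1 := by linarith [le_abs_self R]
  rw [hz (|R| + 1) (by rw [abs_of_pos (by positivity)]; exact hR1),
    hz (-(|R| + 1)) (by rw [abs_neg, abs_of_pos (by positivity)]; exact hR1)] at h
  rw [zero_smul, zero_smul, sub_zero] at h
  rw [← h]
  refine (intervalIntegral.integral_eq_integral_of_support_subset fun x hx => ?_).symm
  have hx' : x ∈ tsupport φ := by
    by_contra hn
    apply hx
    have h1 : x ∉ tsupport (deriv φ) := fun h => hn (tsupport_deriv_subset h)
    simp [image_eq_zero_of_notMem_tsupport hn, image_eq_zero_of_notMem_tsupport h1]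
  have := hR hx'
  rw [mem_closedBall_zero_iff, Real.norm_eq_abs] at this
  constructor <;> linarith [neg_abs_le x, le_abs_self x, le_abs_self R]

theorem IsWeakDeriv.mono {Ω Ω' : Set ℝ} {f g : L2} (h : IsWeakDeriv Ω f g) (hs : Ω' ⊆ Ω) :
    IsWeakDeriv Ω' f g :=
  fun φ hφ hc hφs => h φ hφ hc (hφs.trans hs)

theorem locallyIntegrable_coe (f : L2) : LocallyIntegrable (f : ℝ → ℂ) volume :=
  (Lp.memLp f).locallyIntegrable (by norm_num)

theorem isWeakDeriv_univ_of_ae_eq_primitive {f g : L2} {c : ℂ}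
    (h : ∀ᵐ x : ℝ, f x = c + ∫ t in (0 : ℝ)..x, g t) : IsWeakDeriv univ f g := by
  intro φ hφ hc _
  rw [← integral_deriv_smul_primitive (locallyIntegrable_coe g) c hφ hc]
  refine integral_congr_ae ?_
  filter_upwards [h] with x hx
  rw [hx]

/-- A test function with vanishing integral supported in an interval is the derivative of a test
function supported in the same interval. -/
theorem exists_test_primitive {Ω : Set ℝ} (hΩ : OrdConnected Ω) {θ : ℝ → ℝ}
    (hθ : ContDiff ℝ ∞ θ) (hc : HasCompactSupport θ) (hs : tsupport θ ⊆ Ω) (h0 : ∫ x, θ x = 0) :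
    ∃ ψ : ℝ → ℝ, ContDiff ℝ ∞ ψ ∧ HasCompactSupport ψ ∧ tsupport ψ ⊆ Ω ∧ deriv ψ = θ := by
  by_cases hne : (tsupport θ).Nonempty
  swap
  · rw [not_nonempty_iff_eq_empty, tsupport_eq_empty_iff] at hne
    subst hne
    exact ⟨0, contDiff_const, HasCompactSupport.zero, by simp [tsupport], by ext; simp⟩
  -- The primitive from `a` vanishes left of the support and, as the total integral is zero, also
  -- right of it. Order connectedness keeps `Icc a b` inside `Ω`.
  obtain ⟨a, ha, ha'⟩ := hc.isCompact.exists_isLeast hne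
  obtain ⟨b, hb, hb'⟩ := hc.isCompact.exists_isGreatest hne
  have hcont := hθ.continuous
  have hder : ∀ x, HasDerivAt (fun x => ∫ t in a..x, θ t) (θ x) x := fun x =>
    intervalIntegral.integral_hasDerivAt_right (hcont.intervalIntegrable _ _)
      (hcont.stronglyMeasurableAtFilter _ _) hcont.continuousAt
  have hderiv : deriv (fun x => ∫ t in a..x, θ t) = θ := funext fun x => (hder x).deriv
  have hzero : ∀ x ∉ Icc a b, (∫ t in a..x, θ t) = 0 := by
    intro x hx
    rcases lt_or_ge x a with hxa | hxa
    · refine intervalIntegral.integral_zero_ae ?_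
      have : ∀ᵐ t : ℝ, t ≠ a := by simp [ae_iff]
      filter_upwards [this] with t hta ht
      rw [uIoc_of_ge hxa.le] at ht
      by_contra hn
      exact absurd (ha' (subset_tsupport _ hn)) (not_le.2 (lt_of_le_of_ne ht.2 hta))
    · have hxb : b < x := by
        by_contra hn
        exact hx ⟨hxa, not_lt.1 hn⟩
      rw [← h0]
      have h1 : ∫ t in a..x, θ t = ∫ t in Icc a x, θ t := by
        rw [intervalIntegral.integral_of_le hxa, integral_Icc_eq_integral_Ioc]
      rw [h1]
      refine setIntegral_eq_integral_of_forall_compl_eq_zero fun t ht => ?_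
      by_contra hn
      have := subset_tsupport _ hn
      exact ht ⟨ha' this, (hb' this).trans hxb.le⟩
  have hsub : tsupport (fun x => ∫ t in a..x, θ t) ⊆ Icc a b :=
    closure_minimal (fun x hx => by by_contra hn; exact hx (hzero x hn)) isClosed_Icc
  refine ⟨_, ?_, ?_, ?_, hderiv⟩
  · rw [contDiff_infty_iff_deriv, hderiv]
    exact ⟨fun x => (hder x).differentiableAt, hθ⟩
  · exact isCompact_Icc.of_isClosed_subset (isClosed_tsupport _) hsub
  · exact hsub.trans (hΩ.out (hs ha) (hs hb))

/-- A locally integrable function with vanishing weak derivative in an interval is constant. -/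
theorem exists_ae_eq_const {Ω : Set ℝ} (hΩ : OrdConnected Ω) (ho : IsOpen Ω) (hne : Ω.Nonempty)
    {w : ℝ → ℂ} (hw : LocallyIntegrable w volume)
    (h : ∀ φ : ℝ → ℝ, ContDiff ℝ ∞ φ → HasCompactSupport φ → tsupport φ ⊆ Ω →
      ∫ x, deriv φ x • w x = 0) :
    ∃ c : ℂ, ∀ᵐ x : ℝ, x ∈ Ω → w x = c := by
  obtain ⟨η, hη, hηc, hηs, hη1⟩ : ∃ η : ℝ → ℝ, ContDiff ℝ ∞ η ∧ HasCompactSupport η ∧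
      tsupport η ⊆ Ω ∧ ∫ x, η x = 1 := by
    obtain ⟨x, hx⟩ := hne
    obtain ⟨r, hr, hrs⟩ := Metric.isOpen_iff.1 ho x hx
    let B : ContDiffBump x := ⟨r / 3, r / 2, by positivity, by linarith⟩
    refine ⟨B.normed volume, B.contDiff_normed, B.hasCompactSupport_normed, ?_,
      B.integral_normed⟩
    rw [B.tsupport_normed_eq]
    exact (Metric.closedBall_subset_ball (by simp only [B]; linarith)).trans hrs
  have hηi : Integrable η := hη.continuous.integrable_of_hasCompactSupport hηc
  set c : ℂ := ∫ x, η x • w x with hcdef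
  refine ⟨c, ?_⟩
  have key := ho.ae_eq_zero_of_integral_contDiff_smul_eq_zero (f := fun x => w x - c) (μ := volume)
    ((hw.sub (locallyIntegrable_const c)).locallyIntegrableOn _) ?_
  · filter_upwards [key] with x hx hx'
    exact sub_eq_zero.1 (hx hx')
  intro φ hφ hφc hφs
  have hφi : Integrable φ := hφ.continuous.integrable_of_hasCompactSupport hφc
  -- The argument of du Bois-Reymond: `φ - I η` has integral zero, so it is the derivative of a test
  -- function and is annihilated by `w`. Hence `∫ φ w = I c`.
  set I : ℝ := ∫ x, φ x with hI
  have hsub : tsupport (fun x => φ x - I * η x) ⊆ tsupport φ ∪ tsupport η := by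
    refine (tsupport_sub φ (fun x => I * η x)).trans (union_subset_union_right _ ?_)
    exact tsupport_mul_subset_right
  have hθc : HasCompactSupport (fun x => φ x - I * η x) :=
    (hφc.isCompact.union hηc.isCompact).of_isClosed_subset (isClosed_tsupport _) hsub
  obtain ⟨ψ, hψ, hψc, hψs, hd⟩ := exists_test_primitive hΩ
    (θ := fun x => φ x - I * η x) (hφ.sub (contDiff_const.mul hη)) hθc
    (hsub.trans (union_subset hφs hηs)) (by
      rw [integral_sub hφi (hηi.const_mul I), integral_const_mul, hη1, hI]; ring)
  have h1 := h ψ hψ hψc hψs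
  rw [hd] at h1
  have i1 := hw.integrable_smul_left_of_hasCompactSupport hφ.continuous hφc
  have i2 := hw.integrable_smul_left_of_hasCompactSupport hη.continuous hηc
  have h2 : ∫ x, (φ x - I * η x) • w x = (∫ x, φ x • w x) - I • c := by
    simp only [sub_smul, mul_smul]
    have i3 : Integrable fun x => I • η x • w x := i2.smul I
    rw [integral_sub i1 i3, integral_smul]
  simp only [smul_sub]
  rw [integral_sub i1 (hφi.smul_const c), integral_smul_const, ← h2, h1]

/-- The difference of `f` and the primitive of `g` has zero weak derivative in `Ω`. The base point
`0` need not lie in `Ω`: on a half-line starting at `0`, `c` is the one-sided limit there. -/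
theorem IsWeakDeriv.exists_ae_eq_primitive {Ω : Set ℝ} (hΩ : OrdConnected Ω) (ho : IsOpen Ω)
    (hne : Ω.Nonempty) {f g : L2} (h : IsWeakDeriv Ω f g) :
    ∃ c : ℂ, ∀ᵐ x : ℝ, x ∈ Ω → f x = c + ∫ t in (0 : ℝ)..x, g t := by
  have hg := locallyIntegrable_coe g
  have hcont : Continuous fun x => ∫ t in (0 : ℝ)..x, g t :=
    intervalIntegral.continuous_primitive (intervalIntegrable_of_locallyIntegrable hg) 0
  obtain ⟨c, hc⟩ := exists_ae_eq_const hΩ ho hne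
    (w := fun x => f x - ∫ t in (0 : ℝ)..x, g t)
    ((locallyIntegrable_coe f).sub hcont.locallyIntegrable) (by
      intro φ hφ hφc hφs
      have hd : Continuous (deriv φ) := hφ.continuous_deriv (by simp)
      have h1 := h φ hφ hφc hφs
      have h2 := integral_deriv_smul_primitive hg 0 hφ hφc
      simp only [zero_add] at h2
      simp only [smul_sub]
      have i2 : Integrable fun x => deriv φ x • ∫ t in (0 : ℝ)..x, g t :=
        (hd.smul hcont).integrable_of_hasCompactSupport hφc.deriv.smul_right
      rw [integral_sub (integrable_test_smul f hd hφc.deriv) i2, h1, h2, sub_self])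
  refine ⟨c, ?_⟩
  filter_upwards [hc] with x hx hx'
  rw [← hx hx']
  ring

/-! ### One-sided limits at the origin. -/

section Traces

/-- `f` is a primitive of `g` on each half-line, with one-sided limits `p` and `m` at `0`. -/
structure HasTraces (f g : L2) (p m : ℂ) : Prop where
  right : ∀ᵐ x : ℝ, 0 < x → f x = p + ∫ t in (0 : ℝ)..x, g t
  left : ∀ᵐ x : ℝ, x < 0 → f x = m + ∫ t in (0 : ℝ)..x, g t

variable {f g f' g' : L2} {p m p' m' : ℂ}

theorem intervalIntegrable_coe (f : L2) (a b : ℝ) : IntervalIntegrable f volume a b :=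
  intervalIntegrable_of_locallyIntegrable (locallyIntegrable_coe f) a b

theorem continuous_primitive_coe (c : ℂ) (g : L2) :
    Continuous fun x => c + ∫ t in (0 : ℝ)..x, g t :=
  continuous_const.add (intervalIntegral.continuous_primitive (intervalIntegrable_coe g) 0)

theorem intervalIntegral_coe_add (g g' : L2) (x : ℝ) :
    ∫ t in (0 : ℝ)..x, (g + g' : L2) t = (∫ t in (0 : ℝ)..x, g t) + ∫ t in (0 : ℝ)..x, g' t := by
  rw [← intervalIntegral.integral_add (intervalIntegrable_coe g 0 x)
    (intervalIntegrable_coe g' 0 x)]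
  refine intervalIntegral.integral_congr_ae ?_
  filter_upwards [Lp.coeFn_add g g'] with t ht _
  rw [ht, Pi.add_apply]

theorem intervalIntegral_coe_smul (c : ℂ) (g : L2) (x : ℝ) :
    ∫ t in (0 : ℝ)..x, (c • g : L2) t = c * ∫ t in (0 : ℝ)..x, g t := by
  rw [← intervalIntegral.integral_const_mul]
  refine intervalIntegral.integral_congr_ae ?_
  filter_upwards [Lp.coeFn_smul c g] with t ht _
  rw [ht, Pi.smul_apply, smul_eq_mul]

theorem HasTraces.add (h : HasTraces f g p m) (h' : HasTraces f' g' p' m') :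
    HasTraces (f + f') (g + g') (p + p') (m + m') := by
  constructor
  · filter_upwards [h.right, h'.right, Lp.coeFn_add f f'] with x hx hx' hs h0
    rw [hs, Pi.add_apply, hx h0, hx' h0, intervalIntegral_coe_add]
    ring
  · filter_upwards [h.left, h'.left, Lp.coeFn_add f f'] with x hx hx' hs h0
    rw [hs, Pi.add_apply, hx h0, hx' h0, intervalIntegral_coe_add]
    ring

theorem HasTraces.smul (c : ℂ) (h : HasTraces f g p m) :
    HasTraces (c • f) (c • g) (c * p) (c * m) := by
  constructor
  · filter_upwards [h.right, Lp.coeFn_smul c f] with x hx hs h0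
    rw [hs, Pi.smul_apply, hx h0, intervalIntegral_coe_smul, smul_eq_mul]
    ring
  · filter_upwards [h.left, Lp.coeFn_smul c f] with x hx hs h0
    rw [hs, Pi.smul_apply, hx h0, intervalIntegral_coe_smul, smul_eq_mul]
    ring

theorem HasTraces.hasRightLimit (h : HasTraces f g p m) : HasRightLimit f 0 p := by
  have hc := continuous_primitive_coe p g
  refine ⟨_, hc.continuousOn, ?_, ?_⟩
  · rw [EventuallyEq, ae_restrict_iff' measurableSet_Ioi]
    exact h.right
  · have := hc.tendsto 0
    simp only [intervalIntegral.integral_same, add_zero] at this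
    exact this.mono_left nhdsWithin_le_nhds

theorem HasTraces.hasLeftLimit (h : HasTraces f g p m) : HasLeftLimit f 0 m := by
  have hc := continuous_primitive_coe m g
  refine ⟨_, hc.continuousOn, ?_, ?_⟩
  · rw [EventuallyEq, ae_restrict_iff' measurableSet_Iio]
    exact h.left
  · have := hc.tendsto 0
    simp only [intervalIntegral.integral_same, add_zero] at this
    exact this.mono_left nhdsWithin_le_nhds

theorem ae_ne_zero : ∀ᵐ x : ℝ, x ≠ 0 := by simp [ae_iff]

theorem hasTraces_self_iff :
    HasTraces f g p p ↔ ∀ᵐ x : ℝ, f x = p + ∫ t in (0 : ℝ)..x, g t := by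
  constructor
  · intro h
    filter_upwards [h.right, h.left, ae_ne_zero] with x h1 h2 h0
    rcases lt_or_gt_of_ne h0 with h | h
    · exact h2 h
    · exact h1 h
  · intro h
    constructor <;> filter_upwards [h] with x hx _ using hx

theorem HasTraces.hasValueAt (h : HasTraces f g p p) : HasValueAt f 0 p :=
  ⟨_, continuous_primitive_coe p g, hasTraces_self_iff.1 h, by simp⟩

theorem isWeakDeriv_univ_iff : IsWeakDeriv univ f g ↔ ∃ p, HasTraces f g p p := by
  constructor
  · intro h
    obtain ⟨c, hc⟩ := h.exists_ae_eq_primitive ordConnected_univ isOpen_univ univ_nonempty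
    exact ⟨c, hasTraces_self_iff.2 (by simpa using hc)⟩
  · rintro ⟨p, hp⟩
    exact isWeakDeriv_univ_of_ae_eq_primitive (hasTraces_self_iff.1 hp)

theorem integral_Ioi_deriv_of_hasCompactSupport {φ : ℝ → ℝ} (hφ : ContDiff ℝ ∞ φ)
    (hc : HasCompactSupport φ) : ∫ x in Ioi (0 : ℝ), deriv φ x = -φ 0 :=
  hc.integral_Ioi_deriv_eq (hφ.of_le (by simp)) 0

/-- `f` is a primitive on the whole line plus a jump `p - m` on the right. The jump contributes a
multiple of `φ 0`, which is zero for test functions supported off the origin. -/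
theorem HasTraces.isWeakDeriv (h : HasTraces f g p m) : IsWeakDeriv {0}ᶜ f g := by
  intro φ hφ hc hs
  have hd : Continuous (deriv φ) := hφ.continuous_deriv (by simp)
  have h0 : φ 0 = 0 := image_eq_zero_of_notMem_tsupport fun h => hs h rfl
  have i1 : Integrable fun x => deriv φ x • (m + ∫ t in (0 : ℝ)..x, g t) :=
    (hd.smul (continuous_primitive_coe m g)).integrable_of_hasCompactSupport hc.deriv.smul_right
  have i2 : Integrable fun x => (Ioi (0 : ℝ)).indicator (fun x => deriv φ x • (p - m)) x :=
    ((hd.integrable_of_hasCompactSupport hc.deriv).smul_const _).indicator measurableSet_Ioi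
  have key : ∫ x, deriv φ x • f x = ∫ x, (deriv φ x • (m + ∫ t in (0 : ℝ)..x, g t) +
      (Ioi (0 : ℝ)).indicator (fun x => deriv φ x • (p - m)) x) := by
    refine integral_congr_ae ?_
    filter_upwards [h.right, h.left, ae_ne_zero] with x h1 h2 hx
    rcases lt_or_gt_of_ne hx with hx | hx
    · rw [h2 hx, indicator_of_notMem (by simpa using hx.le), add_zero]
    · rw [h1 hx, indicator_of_mem (by simpa using hx), ← smul_add]
      congr 1
      ring
  rw [key, integral_add i1 i2, integral_indicator measurableSet_Ioi, integral_smul_const,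
    integral_Ioi_deriv_of_hasCompactSupport hφ hc, h0,
    integral_deriv_smul_primitive (locallyIntegrable_coe g) m hφ hc]
  simp

theorem isWeakDeriv_compl_iff : IsWeakDeriv {0}ᶜ f g ↔ ∃ p m, HasTraces f g p m := by
  refine ⟨fun h => ?_, fun ⟨p, m, h⟩ => h.isWeakDeriv⟩
  obtain ⟨p, hp⟩ := (h.mono (Ω' := Ioi 0) (fun x hx => ne_of_gt hx)).exists_ae_eq_primitive
    ordConnected_Ioi isOpen_Ioi nonempty_Ioi
  obtain ⟨m, hm⟩ := (h.mono (Ω' := Iio 0) (fun x hx => ne_of_lt hx)).exists_ae_eq_primitive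
    ordConnected_Iio isOpen_Iio nonempty_Iio
  exact ⟨p, m, hp, hm⟩

theorem HasValueAt.unique {x : ℝ} {a b : ℂ} (h : HasValueAt f x a) (h' : HasValueAt f x b) :
    a = b := by
  obtain ⟨u, hu, hf, rfl⟩ := h
  obtain ⟨v, hv, hf', rfl⟩ := h'
  rw [(hu.ae_eq_iff_eq volume hv).1 (hf.symm.trans hf')]

theorem HasRightLimit.unique {x : ℝ} {a b : ℂ} (h : HasRightLimit f x a)
    (h' : HasRightLimit f x b) : a = b := by
  obtain ⟨u, hu, hf, ha⟩ := h
  obtain ⟨v, hv, hf', hb⟩ := h'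
  have he : EqOn u v (Ioi x) :=
    Measure.eqOn_open_of_ae_eq (hf.symm.trans hf') isOpen_Ioi hu hv
  exact tendsto_nhds_unique (ha.congr' (eventually_nhdsWithin_of_forall he)) hb

theorem HasLeftLimit.unique {x : ℝ} {a b : ℂ} (h : HasLeftLimit f x a)
    (h' : HasLeftLimit f x b) : a = b := by
  obtain ⟨u, hu, hf, ha⟩ := h
  obtain ⟨v, hv, hf', hb⟩ := h'
  have he : EqOn u v (Iio x) :=
    Measure.eqOn_open_of_ae_eq (hf.symm.trans hf') isOpen_Iio hu hv
  exact tendsto_nhds_unique (ha.congr' (eventually_nhdsWithin_of_forall he)) hb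

end Traces

/-! ### Operator domains in terms of traces. -/

section Domains

variable {ζ : L2}

theorem mem_sobolev_one_iff {Ω : Set ℝ} : ζ ∈ sobolev Ω 1 ↔ ∃ g, IsWeakDeriv Ω ζ g :=
  ⟨fun ⟨g, _, h⟩ => ⟨g, h⟩, fun ⟨g, h⟩ => ⟨g, Submodule.mem_top, h⟩⟩

theorem mem_sobolev_two_iff {Ω : Set ℝ} :
    ζ ∈ sobolev Ω 2 ↔ ∃ g h, IsWeakDeriv Ω ζ g ∧ IsWeakDeriv Ω g h :=
  ⟨fun ⟨g, ⟨h, _, hh⟩, hg⟩ => ⟨g, h, hg, hh⟩,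
    fun ⟨g, h, hg, hh⟩ => ⟨g, ⟨h, Submodule.mem_top, hh⟩, hg⟩⟩

theorem IsWeakDeriv.unique_compl {f g g' : L2} (h : IsWeakDeriv {0}ᶜ f g)
    (h' : IsWeakDeriv {0}ᶜ f g') : g = g' :=
  IsWeakDeriv.unique isOpen_compl_singleton (by simp) h h'

theorem mem_freeLaplacian_domain_iff : ζ ∈ freeLaplacian.domain ↔
    ∃ g h z p, HasTraces ζ g z z ∧ HasTraces g h p p := by
  change ζ ∈ sobolev univ 2 ↔ _
  simp only [mem_sobolev_two_iff, isWeakDeriv_univ_iff]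
  grind

theorem freeLaplacian_apply (ζ : freeLaplacian.domain) {g h : L2} (hg : IsWeakDeriv univ ζ g)
    (hh : IsWeakDeriv univ g h) : freeLaplacian ζ = -h :=
  congrArg Neg.neg (secondWeakDeriv_eq isOpen_univ (by simp) ζ hg hh)

/-- The `H¹`, `H²` and boundary conditions each supply a first derivative; uniqueness off `0`
identifies them, and uniqueness of limits identifies the boundary values with the traces. -/
theorem mem_deltaOp_domain_iff {σ : WithTop ℝ} : ζ ∈ (deltaOp σ).domain ↔
    ∃ g h z p m, HasTraces ζ g z z ∧ HasTraces g h p m ∧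
      (∀ s : ℝ, σ = s → p - m = s * z) ∧ (σ = ⊤ → z = 0) := by
  change ((ζ ∈ sobolev univ 1 ∧ BoundaryCondition σ ζ) ∧ ζ ∈ sobolev {0}ᶜ 2) ↔ _
  rw [mem_sobolev_one_iff, mem_sobolev_two_iff]
  constructor
  · rintro ⟨⟨⟨g, hg⟩, ⟨g₁, z, p, m, hg₁, hz, hp, hm, hs, ht⟩⟩, g₂, h, hg₂, hh⟩
    have hg' := hg.mono (subset_univ {0}ᶜ)
    obtain rfl := hg'.unique_compl hg₁
    obtain rfl := hg'.unique_compl hg₂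
    obtain ⟨z', hz'⟩ := isWeakDeriv_univ_iff.1 hg
    obtain ⟨p', m', hpm⟩ := isWeakDeriv_compl_iff.1 hh
    obtain rfl := hz.unique hz'.hasValueAt
    obtain rfl := hp.unique hpm.hasRightLimit
    obtain rfl := hm.unique hpm.hasLeftLimit
    exact ⟨g, h, z, p, m, hz', hpm, hs, ht⟩
  · rintro ⟨g, h, z, p, m, hz, hpm, hs, ht⟩
    exact ⟨⟨⟨g, isWeakDeriv_univ_iff.2 ⟨z, hz⟩⟩, g, z, p, m, hz.isWeakDeriv, hz.hasValueAt,
      hpm.hasRightLimit, hpm.hasLeftLimit, hs, ht⟩, g, h, hz.isWeakDeriv, hpm.isWeakDeriv⟩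

theorem deltaOp_apply {σ : WithTop ℝ} (ζ : (deltaOp σ).domain) {g h : L2}
    (hg : IsWeakDeriv {0}ᶜ ζ g) (hh : IsWeakDeriv {0}ᶜ g h) : deltaOp σ ζ = -h :=
  congrArg Neg.neg (secondWeakDeriv_eq isOpen_compl_singleton (by simp) ⟨ζ, ζ.2.2⟩ hg hh)

end Domains

/-! ### The free operator: symmetry and surjectivity of `A + 1`. -/

section FreeOperator

/-- A test function as an element of `L²(ℝ)`. -/
def testToL2 (φ : ℝ → ℝ) (hφ : Continuous φ) (hc : HasCompactSupport φ) : L2 :=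
  MemLp.toLp (fun x => (φ x : ℂ))
    ((Complex.continuous_ofReal.comp hφ).memLp_of_hasCompactSupport
      (hc.comp_left (g := fun r : ℝ => (r : ℂ)) Complex.ofReal_zero))

theorem coeFn_testToL2 {φ : ℝ → ℝ} (hφ : Continuous φ) (hc : HasCompactSupport φ) :
    testToL2 φ hφ hc =ᵐ[volume] fun x => (φ x : ℂ) :=
  MemLp.coeFn_toLp _

theorem inner_testToL2 {φ : ℝ → ℝ} (hφ : Continuous φ) (hc : HasCompactSupport φ) (f : L2) :
    inner ℂ (testToL2 φ hφ hc) f = ∫ x, φ x • f x := by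
  rw [L2.inner_def]
  refine integral_congr_ae ?_
  filter_upwards [coeFn_testToL2 hφ hc] with x hx
  rw [hx]
  simp [mul_comm]

theorem isWeakDeriv_testToL2 {φ : ℝ → ℝ} (hφ : ContDiff ℝ ∞ φ) (hc : HasCompactSupport φ) :
    IsWeakDeriv univ (testToL2 φ hφ.continuous hc)
      (testToL2 (deriv φ) (hφ.continuous_deriv (by simp)) hc.deriv) := by
  have hd : Continuous (deriv φ) := hφ.continuous_deriv (by simp)
  refine isWeakDeriv_univ_of_ae_eq_primitive (c := φ 0) ?_
  filter_upwards [coeFn_testToL2 hφ.continuous hc] with x hx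
  have h1 : ∫ t in (0 : ℝ)..x, (testToL2 (deriv φ) hd hc.deriv : L2) t =
      ∫ t in (0 : ℝ)..x, ((deriv φ t : ℝ) : ℂ) := by
    refine intervalIntegral.integral_congr_ae ?_
    filter_upwards [coeFn_testToL2 hd hc.deriv] with t ht _ using ht
  rw [hx, h1, intervalIntegral.integral_ofReal, intervalIntegral.integral_deriv_eq_sub
    (fun t _ => (hφ.differentiable (by simp)) t) (hd.intervalIntegrable _ _)]
  push_cast
  ring

/-- The graph of the weak derivative on `H¹(ℝ)`. -/
def weakDerivGraph : Submodule ℂ (WithLp 2 (L2 × L2)) where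
  carrier := {q | IsWeakDeriv univ q.fst q.snd}
  zero_mem' := IsWeakDeriv.zero _
  add_mem' := fun h h' => h.add h'
  smul_mem' := fun c _ h => h.smul c

/-- Each test function imposes an equation between continuous functionals, since pairing with it is
an inner product in `L²`. -/
theorem isClosed_weakDerivGraph : IsClosed (weakDerivGraph : Set (WithLp 2 (L2 × L2))) := by
  have : (weakDerivGraph : Set (WithLp 2 (L2 × L2))) =
      ⋂ (φ : ℝ → ℝ) (hφ : ContDiff ℝ ∞ φ) (hc : HasCompactSupport φ),
        {q | inner ℂ (testToL2 (deriv φ) (hφ.continuous_deriv (by simp)) hc.deriv) q.fst =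
          -inner ℂ (testToL2 φ hφ.continuous hc) q.snd} := by
    ext q
    simp only [mem_iInter, mem_ofPred_eq, inner_testToL2]
    exact ⟨fun h φ hφ hc => h φ hφ hc (subset_univ _), fun h φ hφ hc _ => h φ hφ hc⟩
  rw [this]
  refine isClosed_iInter fun φ => isClosed_iInter fun hφ => isClosed_iInter fun hc => ?_
  refine isClosed_eq ?_ ?_
  · exact continuous_const.inner (WithLp.continuous_fst 2 _ _)
  · exact (continuous_const.inner (WithLp.continuous_snd 2 _ _)).neg

/-- The weak solution of `u - u'' = v`. -/
theorem exists_weak_solution (v : L2) : ∃ u u' : L2, IsWeakDeriv univ u u' ∧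
    IsWeakDeriv univ u' (u - v) ∧
    ∀ f f' : L2, IsWeakDeriv univ f f' → inner ℂ f' u' = inner ℂ f (v - u) := by
  have : CompleteSpace weakDerivGraph := isClosed_weakDerivGraph.completeSpace_coe
  -- The graph carries the `H¹` inner product. Orthogonality of `(v - u, -u')` to it is exactly the
  -- weak form of `u - u'' = v`.
  set q := weakDerivGraph.starProjection (WithLp.toLp 2 (v, 0)) with hq
  have hmem : IsWeakDeriv univ q.fst q.snd :=
    weakDerivGraph.starProjection_apply_mem (WithLp.toLp 2 (v, 0))
  have horth : ∀ f f' : L2, IsWeakDeriv univ f f' →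
      inner ℂ f' q.snd = inner ℂ f (v - q.fst) := by
    intro f f' hf
    have h1 := weakDerivGraph.sub_starProjection_mem_orthogonal (WithLp.toLp 2 (v, 0))
    have h2 := (Submodule.mem_orthogonal _ _).1 h1 (WithLp.toLp 2 (f, f')) hf
    rw [← hq, WithLp.prod_inner_apply] at h2
    change inner ℂ f (v - q.fst) + inner ℂ f' (0 - q.snd) = 0 at h2
    rw [zero_sub, inner_neg_right] at h2
    linear_combination -h2
  refine ⟨q.fst, q.snd, hmem, ?_, horth⟩
  intro φ hφ hc _
  have h1 := horth _ _ (isWeakDeriv_testToL2 hφ hc)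
  rw [inner_testToL2] at h1
  rw [h1, ← neg_sub, inner_neg_right, inner_testToL2]

/-- The product `exp (-s x) k` is constant, so `k = c exp (s x)`. For `c ≠ 0` this has modulus at
least `|c|` on a half-line, contradicting square integrability. -/
theorem eq_zero_of_isWeakDeriv_smul_self {k : L2} {s : ℝ} (hs : s ≠ 0)
    (h : IsWeakDeriv univ k ((s : ℂ) • k)) : k = 0 := by
  obtain ⟨c, hc⟩ := isWeakDeriv_univ_iff.1 h
  rw [hasTraces_self_iff] at hc
  set g : L2 := (s : ℂ) • k with hg
  have hφ : ContDiff ℝ 1 fun x : ℝ => Real.exp (-s * x) := by fun_prop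
  have hexp : ∀ᵐ x : ℝ, k x = Real.exp (s * x) • c := by
    filter_upwards [hc] with x hx
    have h1 := integral_smul_primitive (locallyIntegrable_coe g) hφ c 0 x
    have h2 : ∫ y in (0 : ℝ)..x, (deriv (fun x => Real.exp (-s * x)) y •
        (c + ∫ t in (0 : ℝ)..y, g t) + Real.exp (-s * y) • g y) = ∫ y in (0 : ℝ)..x, (0 : ℂ) := by
      refine intervalIntegral.integral_congr_ae ?_
      filter_upwards [hc, Lp.coeFn_smul (s : ℂ) k] with y hy hy' _
      have hd : deriv (fun x => Real.exp (-s * x)) y = -s * Real.exp (-s * y) := by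
        have := ((hasDerivAt_id y).const_mul (-s)).exp.deriv
        simpa [mul_comm] using this
      rw [← hy, hd, hg, hy', Pi.smul_apply, smul_eq_mul, Complex.real_smul, Complex.real_smul]
      push_cast
      ring
    rw [h2, intervalIntegral.integral_zero, ← hx] at h1
    simp only [mul_zero, Real.exp_zero, intervalIntegral.integral_same, add_zero, one_smul] at h1
    rw [← sub_eq_zero.1 h1.symm, smul_smul, ← Real.exp_add]
    simp
  by_cases hc0 : c = 0
  · rw [Lp.eq_zero_iff_ae_eq_zero]
    filter_upwards [hexp] with x hx
    rw [hx, hc0, smul_zero, Pi.zero_apply]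
  exfalso
  have hfin := (Lp.memLp k).meas_ge_lt_top (by norm_num) (by norm_num)
    (ε := ‖c‖₊) (by simpa using hc0)
  have hsub : {x : ℝ | 0 ≤ s * x} ≤ᵐ[volume] {x | ‖c‖₊ ≤ ‖k x‖₊} := by
    filter_upwards [hexp] with x hx h0
    change ‖c‖₊ ≤ ‖k x‖₊
    change 0 ≤ s * x at h0
    rw [hx, nnnorm_smul]
    refine le_mul_of_one_le_left zero_le ?_
    rw [← NNReal.coe_le_coe, NNReal.coe_one, coe_nnnorm, Real.norm_eq_abs, Real.abs_exp]
    exact Real.one_le_exp h0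
  have h3 := (measure_mono_ae hsub).trans_lt hfin
  rcases lt_or_gt_of_ne hs with hs | hs
  · have : {x : ℝ | 0 ≤ s * x} = Iic 0 := by
      ext x
      exact ⟨fun h => nonpos_of_mul_nonneg_right h hs, fun h => mul_nonneg_of_nonpos_of_nonpos hs.le h⟩
    rw [this, Real.volume_Iic] at h3
    exact lt_irrefl _ h3
  · have : {x : ℝ | 0 ≤ s * x} = Ici 0 := by
      ext x
      exact mul_nonneg_iff_of_pos_left hs
    rw [this, Real.volume_Ici] at h3
    exact lt_irrefl _ h3

/-- Factor `d² - 1 = (d + 1)(d - 1)`: first `w' + w` vanishes, then `w' = -w` forces `w = 0`. -/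
theorem eq_zero_of_second_weakDeriv_eq_self {w w' : L2} (h : IsWeakDeriv univ w w')
    (h' : IsWeakDeriv univ w' w) : w = 0 := by
  have hk : w' + w = 0 :=
    eq_zero_of_isWeakDeriv_smul_self one_ne_zero (by simpa [add_comm] using h.add h')
  refine eq_zero_of_isWeakDeriv_smul_self (s := -1) (by norm_num) ?_
  rw [eq_neg_of_add_eq_zero_left hk] at h
  simpa using h

/-- Integration by parts on the line: `⟨f', ψ'⟩ = -⟨f, ψ''⟩` for `f ∈ H¹(ℝ)` and `ψ ∈ H²(ℝ)`. -/
theorem inner_weakDeriv_eq {f f' ψ ψ' ψ'' : L2} (hf : IsWeakDeriv univ f f')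
    (h1 : IsWeakDeriv univ ψ ψ') (h2 : IsWeakDeriv univ ψ' ψ'') :
    inner ℂ f' ψ' = -inner ℂ f ψ'' := by
  -- By uniqueness `ψ` is itself the weak solution for `ψ - ψ''`, so the variational identity `H` is
  -- the integration by parts; no approximation by test functions is needed.
  obtain ⟨u, u', hu, hu', H⟩ := exists_weak_solution (ψ - ψ'')
  have e1 := hu.add (h1.smul (-1))
  have e2 := hu'.add (h2.smul (-1))
  have hz : u + (-1 : ℂ) • ψ = 0 := by
    refine eq_zero_of_second_weakDeriv_eq_self e1 ?_
    convert e2 using 1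
    module
  have huψ : u = ψ := by
    rw [neg_one_smul, ← sub_eq_add_neg] at hz
    exact sub_eq_zero.1 hz
  subst huψ
  obtain rfl := hu.unique isOpen_univ (by simp) h1
  rw [H f f' hf, ← inner_neg_right]
  congr 1
  abel

theorem freeLaplacian_symm (u v : freeLaplacian.domain) :
    inner ℂ (freeLaplacian u) (v : L2) = inner ℂ (u : L2) (freeLaplacian v) := by
  obtain ⟨u', u'', hu, hu'⟩ := mem_sobolev_two_iff.1 u.2
  obtain ⟨v', v'', hv, hv'⟩ := mem_sobolev_two_iff.1 v.2
  rw [freeLaplacian_apply u hu hu', freeLaplacian_apply v hv hv', inner_neg_right,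
    ← inner_weakDeriv_eq hu hv hv', ← inner_conj_symm, inner_neg_right,
    ← inner_weakDeriv_eq hv hu hu', inner_conj_symm]

theorem freeLaplacian_add_one_surjective (v : L2) :
    ∃ u : freeLaplacian.domain, freeLaplacian u + (u : L2) = v := by
  obtain ⟨u, u', hu, hu', -⟩ := exists_weak_solution v
  refine ⟨⟨u, mem_sobolev_two_iff.2 ⟨u', _, hu, hu'⟩⟩, ?_⟩
  rw [freeLaplacian_apply _ hu hu']
  simp

end FreeOperator

/-! ### The Green function represents evaluation at the origin. -/

section Green

theorem memLp_exp_neg_abs : MemLp (fun x : ℝ => Real.exp (-|x|)) 2 volume := by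
  have hc : Continuous fun x : ℝ => Real.exp (-|x|) := by fun_prop
  rw [memLp_two_iff_integrable_sq hc.aestronglyMeasurable, ← integrableOn_univ,
    ← Iic_union_Ioi (a := (0 : ℝ)), integrableOn_union]
  constructor
  · refine (integrableOn_exp_mul_Iic (a := 2) (by norm_num) 0).congr_fun (fun x hx => ?_)
      measurableSet_Iic
    change Real.exp (2 * x) = Real.exp (-|x|) ^ 2
    rw [abs_of_nonpos hx, ← Real.exp_nat_mul]
    norm_num
  · refine (integrableOn_exp_mul_Ioi (a := -2) (by norm_num) 0).congr_fun (fun x hx => ?_)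
      measurableSet_Ioi
    change Real.exp (-2 * x) = Real.exp (-|x|) ^ 2
    rw [abs_of_pos hx, ← Real.exp_nat_mul]
    norm_num

theorem memLp_deriv_exp_neg_abs :
    MemLp (fun x : ℝ => if 0 < x then -Real.exp (-x) else Real.exp x) 2 volume := by
  refine memLp_exp_neg_abs.of_le ?_ (ae_of_all _ fun x => ?_)
  · exact (Measurable.ite measurableSet_Ioi (by fun_prop) (by fun_prop)).aestronglyMeasurable
  · split_ifs with h
    · simp [abs_of_pos h]
    · simp [abs_of_nonpos (not_lt.1 h)]

/-- The function `exp (-|x|)`, twice the Green function of `-d²/dx² + 1`. -/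
def green : L2 := MemLp.toLp _ memLp_exp_neg_abs.ofReal

/-- The derivative of `exp (-|x|)`. -/
def greenDeriv : L2 := MemLp.toLp _ memLp_deriv_exp_neg_abs.ofReal

theorem green_of_pos : ∀ᵐ x : ℝ, 0 < x → green x = (Real.exp (-x) : ℝ) := by
  filter_upwards [MemLp.coeFn_toLp (memLp_exp_neg_abs.ofReal (K := ℂ))] with x hx h
  rw [green, hx, abs_of_pos h]
  rfl

theorem green_of_nonpos : ∀ᵐ x : ℝ, x ≤ 0 → green x = (Real.exp x : ℝ) := by
  filter_upwards [MemLp.coeFn_toLp (memLp_exp_neg_abs.ofReal (K := ℂ))] with x hx h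
  rw [green, hx, abs_of_nonpos h, neg_neg]
  rfl

theorem greenDeriv_of_pos : ∀ᵐ x : ℝ, 0 < x → greenDeriv x = (-Real.exp (-x) : ℝ) := by
  filter_upwards [MemLp.coeFn_toLp (memLp_deriv_exp_neg_abs.ofReal (K := ℂ))] with x hx h
  rw [greenDeriv, hx, if_pos h]
  rfl

theorem greenDeriv_of_nonpos : ∀ᵐ x : ℝ, x ≤ 0 → greenDeriv x = (Real.exp x : ℝ) := by
  filter_upwards [MemLp.coeFn_toLp (memLp_deriv_exp_neg_abs.ofReal (K := ℂ))] with x hx h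
  rw [greenDeriv, hx, if_neg (not_lt.2 h)]
  rfl

theorem intervalIntegral_coe_eq_sub (k : L2) {F F' : ℝ → ℝ} (hF : ∀ t, HasDerivAt F (F' t) t)
    (hF' : Continuous F') {x : ℝ} (hk : ∀ᵐ t : ℝ, t ∈ uIoc 0 x → k t = (F' t : ℝ)) :
    ∫ t in (0 : ℝ)..x, k t = (F x - F 0 : ℝ) := by
  rw [intervalIntegral.integral_congr_ae hk, intervalIntegral.integral_ofReal,
    intervalIntegral.integral_eq_sub_of_hasDerivAt (fun t _ => hF t)
      (hF'.intervalIntegrable _ _)]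

theorem hasDerivAt_exp_neg (t : ℝ) : HasDerivAt (fun t => Real.exp (-t)) (-Real.exp (-t)) t := by
  simpa using (hasDerivAt_neg t).exp

theorem hasTraces_green : HasTraces green greenDeriv 1 1 := by
  constructor
  · filter_upwards [green_of_pos] with x hx h
    rw [hx h, intervalIntegral_coe_eq_sub greenDeriv hasDerivAt_exp_neg (by fun_prop)]
    · simp
    · filter_upwards [greenDeriv_of_pos] with t ht h'
      rw [uIoc_of_le h.le] at h'
      exact ht h'.1
  · filter_upwards [green_of_nonpos] with x hx h
    rw [hx h.le, intervalIntegral_coe_eq_sub greenDeriv Real.hasDerivAt_exp (by fun_prop)]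
    · simp
    · filter_upwards [greenDeriv_of_nonpos] with t ht h'
      rw [uIoc_of_ge h.le] at h'
      exact ht h'.2

theorem hasTraces_greenDeriv : HasTraces greenDeriv green (-1) 1 := by
  constructor
  · filter_upwards [greenDeriv_of_pos] with x hx h
    rw [hx h, intervalIntegral_coe_eq_sub green (F := fun t => -Real.exp (-t))
      (F' := fun t => Real.exp (-t)) (fun t => by simpa using! (hasDerivAt_exp_neg t).neg)
      (by fun_prop)]
    · simp
    · filter_upwards [green_of_pos] with t ht h'
      rw [uIoc_of_le h.le] at h'
      exact ht h'.1
  · filter_upwards [greenDeriv_of_nonpos] with x hx h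
    rw [hx h.le, intervalIntegral_coe_eq_sub green Real.hasDerivAt_exp (by fun_prop)]
    · simp
    · filter_upwards [green_of_nonpos] with t ht h'
      rw [uIoc_of_ge h.le] at h'
      exact ht h'.2

/-- The derivative of `exp (-|x|)` jumps from `1` to `-1` at the origin, while functions in `H²(ℝ)`
have a continuous derivative. -/
theorem green_notMem : green ∉ freeLaplacian.domain := by
  intro hmem
  obtain ⟨g, h, z, p, hg, hh⟩ := mem_freeLaplacian_domain_iff.1 hmem
  obtain rfl := hg.isWeakDeriv.unique_compl hasTraces_green.isWeakDeriv
  have h1 := hh.hasRightLimit.unique hasTraces_greenDeriv.hasRightLimit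
  have h2 := hh.hasLeftLimit.unique hasTraces_greenDeriv.hasLeftLimit
  rw [h1] at h2
  norm_num at h2

theorem eq_zero_of_integrableOn_of_tendsto_atTop {F : ℝ → ℂ} (hF : IntegrableOn F (Ioi 0))
    {l : ℂ} (hl : Tendsto F atTop (𝓝 l)) : l = 0 := by
  refine IntegrableAtFilter.eq_zero_of_tendsto (μ := volume) ⟨Ioi 0, Ioi_mem_atTop 0, hF⟩
    (fun s hs => ?_) hl
  obtain ⟨b, hb⟩ := mem_atTop_sets.1 hs
  exact top_unique (Real.volume_Ici (a := b) ▸ measure_mono hb)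

theorem eq_zero_of_integrableOn_of_tendsto_atBot {F : ℝ → ℂ} (hF : IntegrableOn F (Iic 0))
    {l : ℂ} (hl : Tendsto F atBot (𝓝 l)) : l = 0 := by
  refine IntegrableAtFilter.eq_zero_of_tendsto (μ := volume) ⟨Iic 0, Iic_mem_atBot 0, hF⟩
    (fun s hs => ?_) hl
  obtain ⟨b, hb⟩ := mem_atBot_sets.1 hs
  exact top_unique (Real.volume_Iic (a := b) ▸ measure_mono hb)

variable {k k' : L2} {z : ℂ}

/-- On the half-line the integrand is `-(exp (-x) k)'`. The boundary term `exp (-x) k(x)` converges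
because the integral does, and it is integrable as a product of `L²` functions, so its limit is
zero. -/
theorem integral_Ioi_green (hk : HasTraces k k' z z) :
    ∫ x in Ioi (0 : ℝ), (inner ℂ (greenDeriv x) (k' x) + inner ℂ (green x) (k x)) = z := by
  set K : ℝ → ℂ := fun x => z + ∫ t in (0 : ℝ)..x, k' t with hK
  have hkK := hasTraces_self_iff.1 hk
  have hi : Integrable fun x => inner ℂ (greenDeriv x) (k' x) + inner ℂ (green x) (k x) :=
    (L2.integrable_inner (𝕜 := ℂ) greenDeriv k').add (L2.integrable_inner (𝕜 := ℂ) green k)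
  have hlim := intervalIntegral_tendsto_integral_Ioi 0 hi.integrableOn tendsto_id
  have hφ : ContDiff ℝ 1 fun x : ℝ => Real.exp (-x) := by fun_prop
  have hval : ∀ x > (0 : ℝ), (∫ t in (0 : ℝ)..x,
      (inner ℂ (greenDeriv t) (k' t) + inner ℂ (green t) (k t))) = z - Real.exp (-x) • K x := by
    intro x hx
    have h1 := integral_smul_primitive (locallyIntegrable_coe k') hφ z 0 x
    have h2 : ∫ t in (0 : ℝ)..x, (inner ℂ (greenDeriv t) (k' t) + inner ℂ (green t) (k t)) =
        ∫ t in (0 : ℝ)..x, -(deriv (fun x => Real.exp (-x)) t • (z + ∫ s in (0 : ℝ)..t, k' s) +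
          Real.exp (-t) • k' t) := by
      refine intervalIntegral.integral_congr_ae ?_
      filter_upwards [hkK, green_of_pos, greenDeriv_of_pos] with t h3 h4 h5 ht
      rw [uIoc_of_le hx.le] at ht
      rw [← h3, h4 ht.1, h5 ht.1, (hasDerivAt_exp_neg t).deriv]
      simp only [RCLike.inner_apply, Complex.conj_ofReal, Complex.real_smul, Complex.ofReal_neg,
        map_neg]
      ring
    rw [h2, intervalIntegral.integral_neg, h1]
    simp [hK]
  have ht : Tendsto (fun x => Real.exp (-x) • K x) atTop
      (𝓝 (z - ∫ x in Ioi (0 : ℝ), (inner ℂ (greenDeriv x) (k' x) + inner ℂ (green x) (k x)))) := by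
    refine (hlim.const_sub z).congr' ?_
    filter_upwards [Ioi_mem_atTop 0] with x hx
    rw [id, hval x hx]
    ring
  have hint : IntegrableOn (fun x => Real.exp (-x) • K x) (Ioi 0) := by
    refine (L2.integrable_inner (𝕜 := ℂ) green k).integrableOn.congr_fun_ae ?_
    rw [EventuallyEq, ae_restrict_iff' measurableSet_Ioi]
    filter_upwards [hkK, green_of_pos] with t h3 h4 ht
    rw [h4 ht, h3]
    simp only [hK, RCLike.inner_apply, Complex.conj_ofReal, Complex.real_smul, mul_comm]
  exact (sub_eq_zero.1 (eq_zero_of_integrableOn_of_tendsto_atTop hint ht)).symm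

theorem integral_Iic_green (hk : HasTraces k k' z z) :
    ∫ x in Iic (0 : ℝ), (inner ℂ (greenDeriv x) (k' x) + inner ℂ (green x) (k x)) = z := by
  set K : ℝ → ℂ := fun x => z + ∫ t in (0 : ℝ)..x, k' t with hK
  have hkK := hasTraces_self_iff.1 hk
  have hi : Integrable fun x => inner ℂ (greenDeriv x) (k' x) + inner ℂ (green x) (k x) :=
    (L2.integrable_inner (𝕜 := ℂ) greenDeriv k').add (L2.integrable_inner (𝕜 := ℂ) green k)
  have hlim := intervalIntegral_tendsto_integral_Iic 0 hi.integrableOn tendsto_id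
  have hval : ∀ x < (0 : ℝ), (∫ t in x..(0 : ℝ),
      (inner ℂ (greenDeriv t) (k' t) + inner ℂ (green t) (k t))) = z - Real.exp x • K x := by
    intro x hx
    have h1 := integral_smul_primitive (locallyIntegrable_coe k') Real.contDiff_exp z x 0
    have h2 : ∫ t in x..(0 : ℝ), (inner ℂ (greenDeriv t) (k' t) + inner ℂ (green t) (k t)) =
        ∫ t in x..(0 : ℝ), (deriv Real.exp t • (z + ∫ s in (0 : ℝ)..t, k' s) +
          Real.exp t • k' t) := by
      refine intervalIntegral.integral_congr_ae ?_
      filter_upwards [hkK, green_of_nonpos, greenDeriv_of_nonpos] with t h3 h4 h5 ht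
      rw [uIoc_of_le hx.le] at ht
      rw [← h3, h4 ht.2, h5 ht.2, Real.deriv_exp]
      simp only [RCLike.inner_apply, Complex.conj_ofReal, Complex.real_smul]
      ring
    rw [h2, h1]
    simp [hK]
  have ht : Tendsto (fun x => Real.exp x • K x) atBot
      (𝓝 (z - ∫ x in Iic (0 : ℝ), (inner ℂ (greenDeriv x) (k' x) + inner ℂ (green x) (k x)))) := by
    refine (hlim.const_sub z).congr' ?_
    filter_upwards [Iio_mem_atBot 0] with x hx
    rw [id, hval x hx]
    ring
  have hint : IntegrableOn (fun x => Real.exp x • K x) (Iic 0) := by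
    refine (L2.integrable_inner (𝕜 := ℂ) green k).integrableOn.congr_fun_ae ?_
    rw [EventuallyEq, ae_restrict_iff' measurableSet_Iic]
    filter_upwards [hkK, green_of_nonpos] with t h3 h4 ht
    rw [h4 ht, h3]
    simp only [hK, RCLike.inner_apply, Complex.conj_ofReal, Complex.real_smul, mul_comm]
  exact (sub_eq_zero.1 (eq_zero_of_integrableOn_of_tendsto_atBot hint ht)).symm

theorem inner_green (hk : HasTraces k k' z z) :
    inner ℂ greenDeriv k' + inner ℂ green k = 2 * z := by
  have hi : Integrable fun x => inner ℂ (greenDeriv x) (k' x) + inner ℂ (green x) (k x) :=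
    (L2.integrable_inner (𝕜 := ℂ) greenDeriv k').add (L2.integrable_inner (𝕜 := ℂ) green k)
  rw [L2.inner_def, L2.inner_def, ← integral_add (L2.integrable_inner (𝕜 := ℂ) greenDeriv k')
    (L2.integrable_inner (𝕜 := ℂ) green k),
    ← intervalIntegral.integral_Iic_add_Ioi (b := 0) hi.integrableOn hi.integrableOn,
    integral_Iic_green hk, integral_Ioi_green hk]
  ring

theorem singularPair_green : SingularPair freeLaplacian green :=
  ⟨freeLaplacian_symm, freeLaplacian_add_one_surjective, green_notMem⟩

/-- The trace of `u ∈ H²(ℝ)` is its value at `0`. -/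
theorem traceAt_green (u : freeLaplacian.domain) {g h : L2} {p : ℂ} (hg : HasTraces u g z z)
    (hh : HasTraces g h p p) : traceAt freeLaplacian green u = z := by
  have hg' : IsWeakDeriv univ u g := isWeakDeriv_univ_iff.2 ⟨z, hg⟩
  have hh' : IsWeakDeriv univ g h := isWeakDeriv_univ_iff.2 ⟨p, hh⟩
  have h1 := inner_green hg
  rw [inner_weakDeriv_eq (isWeakDeriv_univ_iff.2 ⟨1, hasTraces_green⟩) hg' hh'] at h1
  rw [traceAt, freeLaplacian_apply u hg' hh', inner_add_right, inner_neg_right, h1]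
  ring

theorem exists_traces (u : freeLaplacian.domain) : ∃ (g h : L2) (p : ℂ),
    HasTraces u g (traceAt freeLaplacian green u) (traceAt freeLaplacian green u) ∧
      HasTraces g h p p ∧ freeLaplacian u = -h := by
  obtain ⟨g, h, z, p, hg, hh⟩ := mem_freeLaplacian_domain_iff.1 u.2
  rw [traceAt_green u hg hh]
  exact ⟨g, h, p, hg, hh, freeLaplacian_apply u (isWeakDeriv_univ_iff.2 ⟨z, hg⟩)
    (isWeakDeriv_univ_iff.2 ⟨p, hh⟩)⟩

end Green

/-! ### Identification with the boundary conditions. -/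

section Extensions

/-- In `H`, `a` stands for `u(0)`: the function `u + c G` has value `a + c` and derivative jump
`-2c` at the origin. -/
theorem isPointExtension_deltaOp_of_iff {σ : WithTop ℝ} {α γ : ℝ}
    (H : ∀ a c : ℂ, ((∀ s : ℝ, σ = s → -2 * c = s * (a + c)) ∧ (σ = ⊤ → a + c = 0)) ↔
      γ * a = α * c) : IsPointExtension freeLaplacian green α γ (deltaOp σ) := by
  constructor
  · intro ζ
    rw [mem_deltaOp_domain_iff]
    constructor
    · rintro ⟨g, h, z, p, m, hz, hpm, hs, ht⟩
      -- This choice removes the derivative jump of `ζ - c G`, whose two one-sided derivatives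
      -- become `(p + m) / 2`; hence it lies in `H²(ℝ)`.
      set c : ℂ := -(p - m) / 2 with hc
      have h1 : HasTraces (ζ + (-c) • green) (g + (-c) • greenDeriv) (z - c) (z - c) := by
        convert hz.add (hasTraces_green.smul (-c)) using 1 <;> ring
      have h2 : HasTraces (g + (-c) • greenDeriv) (h + (-c) • green) ((p + m) / 2)
          ((p + m) / 2) := by
        convert hpm.add (hasTraces_greenDeriv.smul (-c)) using 1 <;> rw [hc] <;> ring
      refine ⟨⟨ζ + (-c) • green, mem_freeLaplacian_domain_iff.2 ⟨_, _, _, _, h1, h2⟩⟩, c, ?_, ?_⟩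
      · simp
      · rw [traceAt_green _ h1 h2, ← H, sub_add_cancel]
        refine ⟨fun s hσ => ?_, ht⟩
        rw [← hs s hσ, hc]
        ring
    · rintro ⟨u, c, rfl, huc⟩
      obtain ⟨g, h, p, hg, hh, -⟩ := exists_traces u
      obtain ⟨hs, ht⟩ := (H _ _).2 huc
      have h1 := hg.add (hasTraces_green.smul c)
      have h2 := hh.add (hasTraces_greenDeriv.smul c)
      rw [mul_one] at h1
      refine ⟨_, _, _, _, _, h1, h2, fun s hσ => ?_, ht⟩
      rw [← hs s hσ]
      ring
  · intro f u c hf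
    obtain ⟨g, h, p, hg, hh, hu⟩ := exists_traces u
    have h1 := (hg.add (hasTraces_green.smul c)).isWeakDeriv
    have h2 := (hh.add (hasTraces_greenDeriv.smul c)).isWeakDeriv
    rw [← hf] at h1
    rw [deltaOp_apply f h1 h2, hu]
    abel

theorem isPointExtension_deltaOp_coe (s : ℝ) :
    IsPointExtension freeLaplacian green (2 + s) (-s) (deltaOp s) := by
  refine isPointExtension_deltaOp_of_iff fun a c => ⟨fun h => ?_, fun h => ⟨fun r hr => ?_, ?_⟩⟩
  · have := h.1 s rfl
    push_cast
    linear_combination this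
  · obtain rfl := WithTop.coe_injective hr
    push_cast at h
    linear_combination h
  · intro h'
    exact absurd h' (WithTop.coe_ne_top)

theorem isPointExtension_deltaOp_top :
    IsPointExtension freeLaplacian green (-1) 1 (deltaOp ⊤) := by
  refine isPointExtension_deltaOp_of_iff fun a c => ⟨fun h => ?_, fun h => ⟨fun r hr => ?_, ?_⟩⟩
  · have := h.2 rfl
    push_cast
    linear_combination this
  · exact absurd hr.symm (WithTop.coe_ne_top)
  · intro _
    push_cast at h
    linear_combination h

theorem isPointExtension_freeLaplacian :
    IsPointExtension freeLaplacian green 2 0 freeLaplacian := by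
  constructor
  · intro f
    constructor
    · intro hf
      exact ⟨⟨f, hf⟩, 0, by simp, by simp⟩
    · rintro ⟨u, c, rfl, huc⟩
      have hc : c = 0 := by simpa using huc
      simp [hc]
  · intro f u c hf
    obtain ⟨rfl, rfl⟩ := singularPair_green.decomposition_unique (u := f) (v := u) (c := 0) (d := c)
      (by simpa using hf)
    simp

theorem exists_isPointExtension_deltaOp (σ : WithTop ℝ) : ∃ α γ : ℝ, (α ≠ 0 ∨ γ ≠ 0) ∧
    IsPointExtension freeLaplacian green α γ (deltaOp σ) := by
  induction σ using WithTop.recTopCoe with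
  | top => exact ⟨-1, 1, by simp, isPointExtension_deltaOp_top⟩
  | coe s =>
    refine ⟨_, _, ?_, isPointExtension_deltaOp_coe s⟩
    -- The coefficients `2 + s` and `-s` have sum `2`.
    by_contra! h
    linarith [h.1, h.2]

/-- Rescaling to `α + γ = 2` gives `α = 2 + σ` and `γ = -σ`, which determines `σ`. The one line that
cannot be rescaled so has `α + γ = 0` and is the case `σ = +∞`. -/
theorem IsPointExtension.exists_eq_deltaOp {α γ : ℝ} {T : L2 →ₗ.[ℂ] L2}
    (hT : IsPointExtension freeLaplacian green α γ T) (hαγ : α ≠ 0 ∨ γ ≠ 0) :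
    ∃ σ : WithTop ℝ, T = deltaOp σ := by
  by_cases h : α + γ = 0
  · have hγ : γ ≠ 0 := by
      rintro rfl
      simp_all
    refine ⟨⊤, hT.eq (isPointExtension_deltaOp_top.of_scale hγ ?_ ?_)⟩ <;> linarith
  · refine ⟨((-2 * γ / (α + γ) : ℝ) : WithTop ℝ),
      hT.eq ((isPointExtension_deltaOp_coe _).of_scale (r := (α + γ) / 2)
        (div_ne_zero h two_ne_zero) ?_ ?_)⟩
    · field_simp
      ring
    · field_simp

theorem mem_vanishingAtZero_iff (u : freeLaplacian.domain) :
    (u : L2) ∈ vanishingAtZero ↔ traceAt freeLaplacian green u = 0 := by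
  obtain ⟨g, h, p, hg, hh, -⟩ := exists_traces u
  change HasValueAt u 0 0 ↔ _
  exact ⟨fun h0 => hg.hasValueAt.unique h0, fun h0 => h0 ▸ hg.hasValueAt⟩

theorem minimalOp_le_iff {T : L2 →ₗ.[ℂ] L2} : minimalOp ≤ T ↔
    ∀ u : freeLaplacian.domain, traceAt freeLaplacian green u = 0 →
      ∃ hu : (u : L2) ∈ T.domain, T ⟨u, hu⟩ = freeLaplacian u := by
  constructor
  · intro h u hu
    have hmem : (u : L2) ∈ minimalOp.domain := ⟨(mem_vanishingAtZero_iff u).2 hu, u.2⟩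
    exact ⟨h.1 hmem, (h.2 (x := ⟨u, hmem⟩) (y := ⟨u, h.1 hmem⟩) rfl).symm⟩
  · intro h
    have h' : ∀ f (hf : f ∈ minimalOp.domain), ∃ hu : f ∈ T.domain,
        T ⟨f, hu⟩ = minimalOp ⟨f, hf⟩ :=
      fun f hf => h ⟨f, hf.2⟩ ((mem_vanishingAtZero_iff ⟨f, hf.2⟩).1 hf.1)
    refine ⟨fun f hf => (h' f hf).1, ?_⟩
    rintro ⟨x, hx⟩ ⟨y, hy⟩ rfl
    exact (h' x hx).2.symm

theorem IsPointExtension.minimalOp_le {α γ : ℝ} {T : L2 →ₗ.[ℂ] L2}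
    (hT : IsPointExtension freeLaplacian green α γ T) : minimalOp ≤ T :=
  minimalOp_le_iff.2 fun u hu =>
    ⟨hT.ker_le u hu, by rw [hT.apply_eq _ u 0 (by simp)]; simp⟩

theorem deltaOp_zero : deltaOp 0 = freeLaplacian := by
  have h := isPointExtension_deltaOp_coe 0
  rw [WithTop.coe_zero, add_zero, neg_zero] at h
  exact h.eq isPointExtension_freeLaplacian

theorem mem_deltaOp_top_domain_iff {ζ : L2} : ζ ∈ (deltaOp ⊤).domain ↔
    ζ ∈ sobolev univ 1 ∧ ζ ∈ sobolev {0}ᶜ 2 ∧ HasValueAt ζ 0 0 := by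
  rw [mem_deltaOp_domain_iff, mem_sobolev_one_iff, mem_sobolev_two_iff]
  constructor
  · rintro ⟨g, h, z, p, m, hz, hpm, -, ht⟩
    exact ⟨⟨g, isWeakDeriv_univ_iff.2 ⟨z, hz⟩⟩, ⟨g, h, hz.isWeakDeriv, hpm.isWeakDeriv⟩,
      ht rfl ▸ hz.hasValueAt⟩
  · rintro ⟨⟨g, hg⟩, ⟨g', h, hg', hh⟩, h0⟩
    obtain rfl := (hg.mono (subset_univ _)).unique_compl hg'
    obtain ⟨z, hz⟩ := isWeakDeriv_univ_iff.1 hg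
    obtain ⟨p, m, hpm⟩ := isWeakDeriv_compl_iff.1 hh
    exact ⟨g, h, z, p, m, hz, hpm, fun s hs => absurd hs.symm WithTop.coe_ne_top,
      fun _ => hz.hasValueAt.unique h0⟩

end Extensions

end PointInteraction

end

theorem theorem2p1 :
    (∀ T : L2 →ₗ.[ℂ] L2,
      (IsSelfAdjoint T ∧ minimalOp ≤ T) ↔ ∃ σ : WithTop ℝ, T = deltaOp σ) ∧
    (deltaOp 0 = freeLaplacian ∧ (deltaOp 0).domain = sobolev univ 2) ∧
    (∀ ζ : L2, ζ ∈ (deltaOp ⊤).domain ↔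
      ζ ∈ sobolev univ 1 ∧ ζ ∈ sobolev {0}ᶜ 2 ∧ HasValueAt ζ 0 0) := by
  refine ⟨fun T => ⟨?_, ?_⟩, ⟨deltaOp_zero, by rw [deltaOp_zero]; rfl⟩,
    fun ζ => mem_deltaOp_top_domain_iff⟩
  · rintro ⟨hT, hle⟩
    obtain ⟨α, γ, hαγ, h⟩ :=
      singularPair_green.exists_isPointExtension hT (minimalOp_le_iff.1 hle)
    exact h.exists_eq_deltaOp hαγ
  · rintro ⟨σ, rfl⟩
    obtain ⟨α, γ, hαγ, h⟩ := exists_isPointExtension_deltaOp σ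
    exact ⟨h.isSelfAdjoint singularPair_green hαγ, h.minimalOp_le⟩
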